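/- Let $\rho=\beta+i\gamma$ denote the nontrivial zeros of the Riemann zeta-function. For $T>0$ let $N(T)$ be the number of such zeros, counted with multiplicity, with $0<\gamma\le T$ if $T$ is not the ordinate of a zero, and let $N(T)=\lim_{\delta\to0^+}\frac12\bigl(N(T-\delta)+N(T+\delta)\bigr)$ if it is. Put $$L(T)=\frac{T}{2\pi}\left(\log\frac{T}{2\pi}-1\right)+\frac78,\qquad Q(T)=N(T)-L(T).$$ Let $T_0\ge 2\pi$, and let $\varphi:[T_0,\infty)\to[0,\infty)$ be twice continuously differentiable with $\varphi'(t)\le0$ and $\varphi''(t)\ge0$ on $[T_0,\infty)$ (one-sided derivatives at $T_0$). For $T>T_0$ let $\sum\nolimits'_{T_0\le\gamma\le T}\varphi(\gamma)$ denote the sum over the nontrivial zeros with $T_0\le\gamma\le T$, in which each zero is weighted by its multiplicity and terms with $\gamma=T_0$ or $\gamma=T$ are given an additional weight $\frac12$. Suppose that $$\int_{T_0}^\infty\frac{\varphi(t)}{t}\,dt<\infty.$$ Then the limit $$F(T_0):=\lim_{T\to\infty}\left(\sum\nolimits'_{T_0\le\gamma\le T}\varphi(\gamma)-\frac1{2\pi}\int_{T_0}^{T}\varphi(t)\log\frac{t}{2\pi}\,dt\right)$$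 exists, the integral $\int_{T_0}^\infty\varphi'(t)Q(t)\,dt$ converges absolutely, and $$F(T_0)=-\varphi(T_0)Q(T_0)-\int_{T_0}^\infty\varphi'(t)Q(t)\,dt.$$ -/

import Mathlib

open Set Filter Topology MeasureTheory

noncomputable section

/-- The nontrivial zeros of the Riemann zeta function: the zeros in the open critical strip. -/
def nontrivialZetaZeros : Set ℂ :=
  {ρ : ℂ | riemannZeta ρ = 0 ∧ 0 < ρ.re ∧ ρ.re < 1}

/-- The nontrivial zeros `ρ = β + iγ` whose ordinate `γ` lies in `I`. -/
def zetaZerosWithOrdinateIn (I : Set ℝ) : Set ℂ :=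
  {ρ : ℂ | ρ ∈ nontrivialZetaZeros ∧ ρ.im ∈ I}

/-- There are only finitely many nontrivial zeros with ordinates in a bounded interval, so the
finite sums (`∑ᶠ`) over such zeros used below are genuine. -/
theorem zetaZerosWithOrdinateIn_finite {I : Set ℝ} {a b : ℝ} (h : I ⊆ Icc a b) :
    (zetaZerosWithOrdinateIn I).Finite := by
  have hc : IsCompact (Icc (0 : ℝ) 1 ×ℂ Icc a b) := isCompact_Icc.reProdIm isCompact_Icc
  refine hc.inter_riemannZetaZeros_finite.subset ?_
  rintro ρ ⟨⟨h0, h1, h2⟩, h3⟩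
  exact ⟨Complex.mem_reProdIm.2 ⟨⟨h1.le, h2.le⟩, h h3⟩, h0⟩

/-- The multiplicity of `ρ` as a zero of the Riemann zeta function. -/
def zetaZeroMultiplicity (ρ : ℂ) : ℕ :=
  analyticOrderNatAt riemannZeta ρ

/-- The number of nontrivial zeros, counted with multiplicity, with ordinate in `I`. -/
def zetaZeroCount (I : Set ℝ) : ℕ :=
  ∑ᶠ ρ ∈ zetaZerosWithOrdinateIn I, zetaZeroMultiplicity ρ

/-- The zero counting function `N(T)`. If `T` is not the ordinate of a zero, this is the number of
zeros with `0 < γ ≤ T`; in general it is the mean of the one-sided limits at `T` of that number,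
see `tendsto_zetaN`. -/
def zetaN (T : ℝ) : ℝ :=
  ((zetaZeroCount (Ioc 0 T) : ℝ) + (zetaZeroCount (Ioo 0 T) : ℝ)) / 2

/-- The smooth main term `L(T) = (T / 2π) (log (T / 2π) - 1) + 7 / 8`. -/
def zetaL (T : ℝ) : ℝ :=
  T / (2 * Real.pi) * (Real.log (T / (2 * Real.pi)) - 1) + 7 / 8

/-- `Q(T) = N(T) - L(T)`. -/
def zetaQ (T : ℝ) : ℝ :=
  zetaN T - zetaL T

/-- The primed sum of `φ(γ)` over the ordinates `T₁ ≤ γ ≤ T₂` of nontrivial zeros: zeros are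
weighted by their multiplicities, and terms with `γ = T₁` or `γ = T₂` get an extra factor `1/2`. -/
def zetaPrimedSum (φ : ℝ → ℝ) (T₁ T₂ : ℝ) : ℝ :=
  ∑ᶠ ρ ∈ zetaZerosWithOrdinateIn (Icc T₁ T₂),
    (zetaZeroMultiplicity ρ : ℝ) *
      ((open Classical in if ρ.im = T₁ ∨ ρ.im = T₂ then 1 / 2 else 1) * φ ρ.im)

/-- `N(T)` is the limit of `(N₀(T - δ) + N₀(T + δ)) / 2` as `δ → 0+`, where `N₀(t)` is the number
of zeros with `0 < γ ≤ t`. -/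
theorem tendsto_zetaN (T : ℝ) :
    Tendsto (fun δ : ℝ => ((zetaZeroCount (Ioc 0 (T - δ)) : ℝ) +
      (zetaZeroCount (Ioc 0 (T + δ)) : ℝ)) / 2) (𝓝[>] 0) (𝓝 (zetaN T)) := by
  have hfin : ((Complex.im '' zetaZerosWithOrdinateIn (Icc (T - 1) (T + 1))) \ {T}).Finite :=
    ((zetaZerosWithOrdinateIn_finite (Subset.refl _)).image _).sdiff
  have hn := hfin.isClosed.isOpen_compl.mem_nhds (x := T) (by simp)
  obtain ⟨ε, hε, hb⟩ := Metric.mem_nhds_iff.1 hn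
  have key : ∀ ρ ∈ nontrivialZetaZeros, |ρ.im - T| < min ε 1 → ρ.im = T := by
    intro ρ hρ hd
    by_contra hne
    have h1 := lt_of_lt_of_le hd (min_le_left _ _)
    have h2 := abs_lt.1 (lt_of_lt_of_le hd (min_le_right _ _))
    exact hb (by simpa [Real.dist_eq] using h1 : ρ.im ∈ Metric.ball T ε)
      ⟨⟨ρ, ⟨hρ, by constructor <;> linarith⟩, rfl⟩, hne⟩
  refine Tendsto.congr' ?_ tendsto_const_nhds
  have hm : (0 : ℝ) < min ε 1 := lt_min hε one_pos
  filter_upwards [Ioo_mem_nhdsGT hm] with δ hδ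
  have e1 : zetaZerosWithOrdinateIn (Ioc 0 (T - δ)) = zetaZerosWithOrdinateIn (Ioo 0 T) := by
    ext ρ
    refine ⟨fun h => ⟨h.1, h.2.1, ?_⟩, fun h => ⟨h.1, h.2.1, ?_⟩⟩
    · linarith [h.2.2, hδ.1]
    · by_contra hc
      have := key ρ h.1 (abs_lt.2 ⟨by linarith [hδ.2], by linarith [h.2.2]⟩)
      linarith [h.2.2]
  have e2 : zetaZerosWithOrdinateIn (Ioc 0 (T + δ)) = zetaZerosWithOrdinateIn (Ioc 0 T) := by
    ext ρ
    refine ⟨fun h => ⟨h.1, h.2.1, ?_⟩, fun h => ⟨h.1, h.2.1, ?_⟩⟩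
    · by_contra hc
      have := key ρ h.1 (abs_lt.2 ⟨by linarith, by linarith [h.2.2, hδ.2]⟩)
      linarith
    · linarith [h.2.2, hδ.1]
  simp only [zetaN, zetaZeroCount, e1, e2]
  ring

end

/-! The zero-counting function jumps at each ordinate by the multiplicities there, taking the mean
value at the jump, so partial summation turns the primed sum into φ(T)N(T) − φ(T₀)N(T₀) − ∫φ'N; the
mean value at a jump is exactly what produces the weights 1/2 at the two ends. Since L'(t) = (1/2π)
log(t/2π), integrating ∫φ'L by parts removes the smooth main term. For every finite T this leaves
the exact identity `zetaPrimedSum_sub_integral_eq`: the difference equals φ(T)Q(T) − φ(T₀)Q(T₀) −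
∫φ'Q over [T₀, T].

To let T tend to infinity it suffices to know Q(t) = O(log t). Monotonicity of φ gives φ(T) log T ≤
2∫φ(t)/t dt over [√T, T], which tends to 0 (`tendsto_mul_log_atTop_zero`). Integration by parts
against log bounds ∫|φ'| log t by φ(T₀) log T₀ + ∫φ(t)/t dt (`integrableOn_mul_log`).

The bulk of the proof is the bound on Q, the Riemann–von Mangoldt formula `abs_zetaQ_le`. The
argument principle is applied to the entire function ξ(s) = s(s − 1)Λ(s) on [−1, 2] × [−T, T], and
the symmetry s ↦ 1 − s reduces the boundary to its right half. There ξ is an explicit factor times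
(s − 1)ζ(s). The explicit factor is evaluated by Stirling's formula and gives the main term. The
argument of (s − 1)ζ(s) changes by O(1) along Re s = 2, where Re ζ > 0, and by O(log T) along the
horizontal sides. The latter follows from polynomial growth, by Jensen's inequality and the
Borel–Carathéodory theorem (`abs_im_integral_logDeriv_le`). -/

/-! ### Dividing finitely many zeros out of an entire function. -/

section ZeroFactorization

theorem exists_eq_pow_mul_of_differentiable {f : ℂ → ℂ} (hf : Differentiable ℂ f) {a : ℂ}
    (ha : analyticOrderAt f a ≠ ⊤) :
    ∃ g : ℂ → ℂ, Differentiable ℂ g ∧ g a ≠ 0 ∧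
      ∀ z, f z = (z - a) ^ analyticOrderNatAt f a * g z := by
  classical
  obtain ⟨g₀, hg₀, hne, heq⟩ :=
    ((hf.analyticAt a).analyticOrderNatAt_eq_iff ha (n := analyticOrderNatAt f a)).1 rfl
  set n := analyticOrderNatAt f a
  -- The global quotient, with the removable singularity at a filled in by the value of the local
  -- cofactor, agrees with that cofactor near a.
  have hga : Function.update (fun z => f z / (z - a) ^ n) a (g₀ a) =ᶠ[𝓝 a] g₀ := by
    filter_upwards [heq] with z hz
    by_cases h : z = a
    · simp [h]
    · rw [Function.update_of_ne h, hz, smul_eq_mul,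
        mul_div_cancel_left₀ _ (pow_ne_zero _ (sub_ne_zero.2 h))]
  refine ⟨Function.update (fun z => f z / (z - a) ^ n) a (g₀ a), fun z => ?_, by simpa, fun z => ?_⟩
  · by_cases h : z = a
    · exact h ▸ hga.differentiableAt_iff.2 hg₀.differentiableAt
    · have : Function.update (fun z => f z / (z - a) ^ n) a (g₀ a) =ᶠ[𝓝 z]
          fun z => f z / (z - a) ^ n := by
        filter_upwards [isOpen_ne.mem_nhds h] with w hw
        rw [Function.update_of_ne hw]
      refine this.differentiableAt_iff.2 ((hf z).div ?_ (pow_ne_zero _ (sub_ne_zero.2 h)))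
      fun_prop
  · by_cases h : z = a
    · subst h
      simpa using heq.self_of_nhds
    · rw [Function.update_of_ne h, mul_div_cancel₀ _ (pow_ne_zero _ (sub_ne_zero.2 h))]

/-- An entire function that is not identically zero can be divided by the polynomial that has its
zeros at the points of a finite set `S`. -/
theorem exists_eq_prod_pow_mul_of_differentiable {f : ℂ → ℂ} (hf : Differentiable ℂ f)
    (hne : ∀ z, analyticOrderAt f z ≠ ⊤) (S : Finset ℂ) :
    ∃ g : ℂ → ℂ, Differentiable ℂ g ∧ (∀ ρ ∈ S, g ρ ≠ 0) ∧
      (∀ z, f z = (∏ ρ ∈ S, (z - ρ) ^ analyticOrderNatAt f ρ) * g z) := by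
  classical
  induction S using Finset.induction_on with
  | empty => exact ⟨f, hf, by simp, by simp⟩
  | insert a S ha ih =>
    obtain ⟨g, hg, hgne, hfg⟩ := ih
    have hP : Differentiable ℂ (fun z => ∏ ρ ∈ S, (z - ρ) ^ analyticOrderNatAt f ρ) := by fun_prop
    -- The factors already divided out do not vanish at a, so the quotient keeps the full order of f
    -- there.
    have hord : analyticOrderAt f a = analyticOrderAt g a := by
      have h1 : f = (fun z => ∏ ρ ∈ S, (z - ρ) ^ analyticOrderNatAt f ρ) * g := funext hfg
      conv_lhs => rw [h1]
      rw [analyticOrderAt_mul (hP.analyticAt a) (hg.analyticAt a),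
        (hP.analyticAt a).analyticOrderAt_eq_zero.2, zero_add]
      refine Finset.prod_ne_zero_iff.2 fun ρ hρ => pow_ne_zero _ (sub_ne_zero.2 ?_)
      rintro rfl
      exact ha hρ
    obtain ⟨k, hk, hka, hgk⟩ := exists_eq_pow_mul_of_differentiable hg (hord ▸ hne a)
    refine ⟨k, hk, fun ρ hρ => ?_, fun z => ?_⟩
    · rcases Finset.mem_insert.1 hρ with rfl | h
      · exact hka
      · exact fun h0 => hgne ρ h (by rw [hgk, h0, mul_zero])
    · rw [Finset.prod_insert ha, hfg z, hgk z, analyticOrderNatAt, analyticOrderNatAt, hord]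
      ring

theorem logDeriv_eq_sum_add {f g : ℂ → ℂ} (hg : Differentiable ℂ g) {S : Finset ℂ} {m : ℂ → ℕ}
    (hfg : ∀ z, f z = (∏ ρ ∈ S, (z - ρ) ^ m ρ) * g z) {z : ℂ} (hz : z ∉ S) (hgz : g z ≠ 0) :
    logDeriv f z = ∑ ρ ∈ S, (m ρ : ℂ) * (z - ρ)⁻¹ + logDeriv g z := by
  have h0 : ∀ ρ ∈ S, (z - ρ) ^ m ρ ≠ 0 := fun ρ hρ =>
    pow_ne_zero _ (sub_ne_zero.2 fun h => hz (h ▸ hρ))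
  rw [show f = fun z => (∏ ρ ∈ S, (z - ρ) ^ m ρ) * g z from funext hfg,
    logDeriv_mul z (Finset.prod_ne_zero_iff.2 h0) hgz (by fun_prop) (hg z)]
  congr 1
  rw [logDeriv_prod h0 (fun _ _ => by fun_prop)]
  refine Finset.sum_congr rfl fun ρ _ => ?_
  rw [logDeriv_fun_pow (by fun_prop)]
  simp [logDeriv_apply]

end ZeroFactorization

/-! ### The argument principle on a rectangle. -/

section ArgumentPrinciple

open Complex

/-- The integral over the boundary of the rectangle `[a, b] × [c, d]`. -/
noncomputable def rectIntegral (h : ℂ → ℂ) (a b c d : ℝ) : ℂ :=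
  (∫ x in a..b, h (x + c * I)) - (∫ x in a..b, h (x + d * I)) +
    I * (∫ y in c..d, h (b + y * I)) - I * ∫ y in c..d, h (a + y * I)

theorem rectIntegral_eq_zero {h : ℂ → ℂ} {a b c d : ℝ} (hab : a ≤ b) (hcd : c ≤ d)
    (H : DifferentiableOn ℂ h (Icc a b ×ℂ Icc c d)) : rectIntegral h a b c d = 0 := by
  have := integral_boundary_rect_eq_zero_of_differentiableOn h ⟨a, c⟩ ⟨b, d⟩
    (by simpa [uIcc_of_le hab, uIcc_of_le hcd] using H)
  simpa [rectIntegral] using this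

/-- Rotating the open first quadrant by −i does not cross the branch cut, so the two principal
logarithms differ by exactly πi/2. This is the contribution of one corner of a rectangle. -/
theorem log_eq_log_neg_I_mul_add {u : ℂ} (hr : 0 < u.re) (hi : 0 < u.im) :
    log u = log (-I * u) + Real.pi / 2 * I := by
  have hu : u ≠ 0 := by rintro rfl; simp at hr
  have h1 : |u.arg| < Real.pi / 2 := abs_arg_lt_pi_div_two_iff.2 (Or.inl hr)
  have h2 : 0 ≤ u.arg := arg_nonneg_iff.2 hi.le
  have h3 := abs_lt.1 h1
  have hI : (-I).arg = -(Real.pi / 2) := arg_neg_I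
  have := log_mul_eq_add_log_iff (x := -I) (y := u) (by simp) hu
  rw [this.2, log_neg_I]
  · ring
  · rw [hI]; constructor <;> linarith [Real.pi_pos]

/-- The constant k rotates the segment away from the branch cut; it does not change the derivative
of the logarithm. -/
theorem integral_inv_add_mul {u v : ℂ} (hv : v ≠ 0) {k : ℂ} {a b : ℝ}
    (h : ∀ x ∈ uIcc a b, k * (u + x * v) ∈ slitPlane) :
    ∫ x in a..b, (u + x * v)⁻¹ = (log (k * (u + b * v)) - log (k * (u + a * v))) / v := by
  have hd : ∀ x ∈ uIcc a b, HasDerivAt (fun x : ℝ => log (k * (u + x * v)) / v)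
      ((u + x * v)⁻¹) x := by
    intro x hx
    have h0 := slitPlane_ne_zero (h x hx)
    have h1 : HasDerivAt (fun x : ℝ => k * (u + x * v)) (k * (1 * v)) x :=
      ((ofRealCLM.hasDerivAt.mul_const v).const_add u).const_mul k
    convert! (h1.clog_real (h x hx)).div_const v using 1
    have hk := left_ne_zero_of_mul h0
    have hw := right_ne_zero_of_mul h0
    field_simp
  rw [intervalIntegral.integral_eq_sub_of_hasDerivAt hd, sub_div]
  refine ContinuousOn.intervalIntegrable fun x hx => ?_
  refine ContinuousAt.continuousWithinAt (ContinuousAt.inv₀ (by fun_prop) ?_)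
  exact right_ne_zero_of_mul (slitPlane_ne_zero (h x hx))

/-- On each side a different branch of the logarithm is used: the rotations i, −i, 1, −1 carry the
bottom, top, right and left sides, seen from ρ, into the right half plane. Neighbouring branches
differ by πi/2 at their common corner, and the four corners add up to 2πi. -/
theorem rectIntegral_inv_sub {a b c d : ℝ} {ρ : ℂ} (ha : a < ρ.re) (hb : ρ.re < b)
    (hc : c < ρ.im) (hd : ρ.im < d) :
    rectIntegral (fun z => (z - ρ)⁻¹) a b c d = 2 * Real.pi * I := by
  have e1 := integral_inv_add_mul (u := c * I - ρ) (v := 1) one_ne_zero (k := I) (a := a) (b := b)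
    (fun x _ => Or.inl (by simpa using hc))
  have e2 := integral_inv_add_mul (u := d * I - ρ) (v := 1) one_ne_zero (k := -I) (a := a) (b := b)
    (fun x _ => Or.inl (by simpa using hd))
  have e3 := integral_inv_add_mul (u := b - ρ) (v := I) I_ne_zero (k := 1) (a := c) (b := d)
    (fun x _ => Or.inl (by simpa using hb))
  have e4 := integral_inv_add_mul (u := a - ρ) (v := I) I_ne_zero (k := -1) (a := c) (b := d)
    (fun x _ => Or.inl (by simpa using ha))
  have f1 : ∀ x t : ℝ, (x + t * I - ρ : ℂ) = t * I - ρ + x * 1 := fun _ _ => by ring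
  have f2 : ∀ x t : ℝ, (x + t * I - ρ : ℂ) = x - ρ + t * I := fun _ _ => by ring
  unfold rectIntegral
  simp only [f1 _ c, f1 _ d, f2 a, f2 b]
  rw [e1, e2, e3, e4]
  have c1 := log_eq_log_neg_I_mul_add (u := b - ρ + d * I) (by simpa using hb) (by simpa using hd)
  have c2 := log_eq_log_neg_I_mul_add (u := I * (b - ρ + c * I)) (by simpa using hc)
    (by simpa using hb)
  have c3 := log_eq_log_neg_I_mul_add (u := -(a - ρ + c * I)) (by simpa using ha)
    (by simpa using hc)
  have c4 := log_eq_log_neg_I_mul_add (u := -I * (a - ρ + d * I)) (by simpa using hd)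
    (by simpa using ha)
  have g1 : (d * I - ρ + b * 1 : ℂ) = b - ρ + d * I := by ring
  have g2 : (c * I - ρ + b * 1 : ℂ) = b - ρ + c * I := by ring
  have g3 : (d * I - ρ + a * 1 : ℂ) = a - ρ + d * I := by ring
  have g4 : (c * I - ρ + a * 1 : ℂ) = a - ρ + c * I := by ring
  have k2 : -I * (I * (b - ρ + c * I)) = (b - ρ + c * I : ℂ) := by
    linear_combination (-(b - ρ + c * I : ℂ)) * I_mul_I
  have k3 : -I * -(a - ρ + c * I) = (I * (a - ρ + c * I) : ℂ) := by ring
  have k4 : -I * (-I * (a - ρ + d * I)) = (-(a - ρ + d * I) : ℂ) := by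
    linear_combination ((a - ρ + d * I : ℂ)) * I_mul_I
  rw [k2] at c2
  rw [k3] at c3
  rw [k4] at c4
  simp only [g1, g2, g3, g4, one_mul, neg_one_mul, div_one, mul_div_cancel₀ _ I_ne_zero]
  rw [c1, c2, c3, c4]
  ring

/-- The **argument principle** for an entire function and a rectangle. -/
theorem rectIntegral_logDeriv {f : ℂ → ℂ} (hf : Differentiable ℂ f)
    (hne : ∀ z, analyticOrderAt f z ≠ ⊤) {a b c d : ℝ} (hab : a ≤ b) (hcd : c ≤ d) (S : Finset ℂ)
    (hS : ∀ ρ ∈ S, a < ρ.re ∧ ρ.re < b ∧ c < ρ.im ∧ ρ.im < d)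
    (hzero : ∀ z ∈ Icc a b ×ℂ Icc c d, f z = 0 → z ∈ S) :
    rectIntegral (logDeriv f) a b c d =
      2 * Real.pi * I * ∑ ρ ∈ S, (analyticOrderNatAt f ρ : ℂ) := by
  -- The cofactor g has no zeros on the rectangle, so its logarithmic derivative integrates to 0 by
  -- Cauchy, and only the linear factors contribute.
  obtain ⟨g, hg, hgS, hfg⟩ := exists_eq_prod_pow_mul_of_differentiable hf hne S
  have hg0 : ∀ z ∈ Icc a b ×ℂ Icc c d, g z ≠ 0 := fun z hz h0 =>
    hgS z (hzero z hz (by rw [hfg, h0, mul_zero])) h0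
  have hgd : DifferentiableOn ℂ (logDeriv g) (Icc a b ×ℂ Icc c d) := fun z hz =>
    ((hg.deriv z).div (hg z) (hg0 z hz)).differentiableWithinAt
  have side : ∀ (p : ℝ → ℂ) (s t : ℝ), Continuous p →
      (∀ x ∈ uIcc s t, p x ∈ Icc a b ×ℂ Icc c d ∧ p x ∉ S) →
      ∫ x in s..t, logDeriv f (p x) =
        ∑ ρ ∈ S, (analyticOrderNatAt f ρ : ℂ) * (∫ x in s..t, (p x - ρ)⁻¹) +
          ∫ x in s..t, logDeriv g (p x) := by
    intro p s t hp hx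
    have i1 : ∀ ρ ∈ S, IntervalIntegrable
        (fun x => (analyticOrderNatAt f ρ : ℂ) * (p x - ρ)⁻¹) volume s t := by
      intro ρ hρ
      refine ContinuousOn.intervalIntegrable (continuousOn_const.mul
        (ContinuousOn.inv₀ (by fun_prop) fun x h => sub_ne_zero.2 fun he => ?_))
      exact (hx x h).2 (he ▸ hρ)
    rw [intervalIntegral.integral_congr (g := fun x =>
        ∑ ρ ∈ S, (analyticOrderNatAt f ρ : ℂ) * (p x - ρ)⁻¹ + logDeriv g (p x)),
      intervalIntegral.integral_add, intervalIntegral.integral_finsetSum i1]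
    · simp only [intervalIntegral.integral_const_mul]
    · simpa only [Finset.sum_fn] using IntervalIntegrable.sum S i1
    · exact (hgd.continuousOn.comp hp.continuousOn fun x h => (hx x h).1).intervalIntegrable
    · intro x h
      exact logDeriv_eq_sum_add hg hfg (hx x h).2 (hg0 _ (hx x h).1)
  have key : rectIntegral (logDeriv f) a b c d =
      ∑ ρ ∈ S, (analyticOrderNatAt f ρ : ℂ) * rectIntegral (fun z => (z - ρ)⁻¹) a b c d +
        rectIntegral (logDeriv g) a b c d := by
    unfold rectIntegral
    rw [side (fun x => x + c * I) a b (by fun_prop), side (fun x => x + d * I) a b (by fun_prop),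
      side (fun y => b + y * I) c d (by fun_prop), side (fun y => a + y * I) c d (by fun_prop)]
    · simp only [mul_add, mul_sub, Finset.sum_add_distrib, Finset.sum_sub_distrib, Finset.mul_sum]
      simp only [mul_left_comm I]
      ring
    all_goals
      intro x hx
      rw [uIcc_of_le (by assumption)] at hx
      refine ⟨by simpa [mem_reProdIm, hab, hcd] using hx, fun h => ?_⟩
      have := hS _ h
      simp at this
  rw [key, rectIntegral_eq_zero hab hcd hgd, add_zero, Finset.mul_sum]
  refine Finset.sum_congr rfl fun ρ hρ => ?_
  obtain ⟨h1, h2, h3, h4⟩ := hS ρ hρ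
  rw [rectIntegral_inv_sub h1 h2 h3 h4]
  ring

end ArgumentPrinciple

/-! ### Variation of the argument along a horizontal segment. -/

section HorizontalVariation

open Complex Metric

theorem analyticOrderAt_ne_top_of_differentiable {f : ℂ → ℂ} (hf : Differentiable ℂ f) {c : ℂ}
    (hc : f c ≠ 0) (z : ℂ) : analyticOrderAt f z ≠ ⊤ := by
  have hA : AnalyticOnNhd ℂ f univ := fun w _ => hf.analyticAt w
  refine hA.analyticOrderAt_ne_top_of_isPreconnected isPreconnected_univ (mem_univ c) (mem_univ z) ?_
  rw [(hf.analyticAt c).analyticOrderAt_eq_zero.2 hc]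
  simp

/-- Jensen's inequality for the divisor, rewritten for a finite set of zeros with their orders. -/
theorem exists_zeros_closedBall {f : ℂ → ℂ} (hf : Differentiable ℂ f) {c : ℂ} (hc : f c = 1)
    {r R M : ℝ} (hr : 0 < r) (hrR : r < R) (hM : 1 ≤ M) (hb : ∀ z ∈ closedBall c R, ‖f z‖ ≤ M) :
    ∃ S : Finset ℂ, (∀ z, z ∈ S ↔ z ∈ closedBall c r ∧ f z = 0) ∧
      (∑ ρ ∈ S, (analyticOrderNatAt f ρ : ℝ)) ≤ Real.log M / Real.log (R / r) := by
  have hne := analyticOrderAt_ne_top_of_differentiable hf (c := c) (by simp [hc])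
  have hA : ∀ s : Set ℂ, AnalyticOnNhd ℂ f s := fun s w _ => hf.analyticAt w
  set D := MeromorphicOn.divisor f (closedBall c |r|) with hD
  have hfin : D.support.Finite := D.finiteSupport (isCompact_closedBall _ _)
  have hval : ∀ z ∈ closedBall c |r|, D z = analyticOrderNatAt f z := by
    intro z hz
    rw [hD, MeromorphicOn.AnalyticOnNhd.divisor_apply (hA _) hz, ← Nat.cast_analyticOrderNatAt (hne z)]
    rfl
  have hR : 0 < R := hr.trans hrR
  have hJ := (hA (closedBall c |R|)).sum_divisor_le (r := r) (M := M) (by simpa using hr.ne')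
    (by rwa [abs_of_pos hr, abs_of_pos hR]) hM
    (by simp [hc]) (fun z hz => hb z (by rw [abs_of_pos hR] at hz; exact sphere_subset_closedBall hz))
  rw [hc, norm_one, div_one, ← hD] at hJ
  refine ⟨hfin.toFinset, fun z => ?_, le_trans (le_of_eq ?_) hJ⟩
  · rw [Finite.mem_toFinset]
    constructor
    · intro h
      have hz := D.supportWithinDomain h
      rw [Function.mem_support, hval z hz, Nat.cast_ne_zero] at h
      exact ⟨by rwa [abs_of_pos hr] at hz, apply_eq_zero_of_analyticOrderNatAt_ne_zero h⟩
    · rintro ⟨hz, h0⟩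
      rw [Function.mem_support, hval z (by rwa [abs_of_pos hr]), Nat.cast_ne_zero]
      intro h
      have := (hf.analyticAt z).analyticOrderAt_eq_zero.1
        (by rw [← Nat.cast_analyticOrderNatAt (hne z), h]; rfl)
      exact this h0
  · rw [finsum_eq_sum_of_support_subset _ (s := hfin.toFinset) (by simp)]
    push_cast
    refine Finset.sum_congr rfl fun ρ hρ => ?_
    rw [hval ρ (D.supportWithinDomain ((Finite.mem_toFinset _).1 hρ))]
    simp

/-- On a disc g'/g has a primitive l, and g · exp(−l) has zero derivative. -/
theorem exists_log_ball {g : ℂ → ℂ} (hg : Differentiable ℂ g) {c : ℂ} {r : ℝ} (hr : 0 < r)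
    (h0 : ∀ z ∈ ball c r, g z ≠ 0) :
    ∃ l : ℂ → ℂ, l c = 0 ∧ (∀ z ∈ ball c r, HasDerivAt l (logDeriv g z) z) ∧
      ∀ z ∈ ball c r, exp (l z) = g z / g c := by
  have hd : DifferentiableOn ℂ (logDeriv g) (ball c r) := fun z hz =>
    ((hg.deriv z).div (hg z) (h0 z hz)).differentiableWithinAt
  obtain ⟨l, hl0, hl⟩ := hd.isExactOn_ball.with_val_at c 0
  refine ⟨l, hl0, hl, fun z hz => ?_⟩
  have hc : c ∈ ball c r := mem_ball_self hr
  have hconst : ∀ w ∈ ball c r, HasDerivAt (fun w => g w * exp (-l w)) 0 w := by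
    intro w hw
    convert! (hg w).hasDerivAt.mul (hl w hw).neg.cexp using 1
    rw [logDeriv_apply]
    have := h0 w hw
    field_simp
    ring
  have := isOpen_ball.is_const_of_deriv_eq_zero (convex_ball c r).isPreconnected
    (fun w hw => (hconst w hw).differentiableAt.differentiableWithinAt)
    (fun w hw => (hconst w hw).deriv) hz hc
  simp only [hl0, neg_zero, exp_zero, mul_one, exp_neg] at this
  have h1 := exp_ne_zero (l z)
  have h2 := h0 c hc
  field_simp at this ⊢
  exact this.symm

/-- The path stays off the real axis, so the integral is a difference of principal logarithms and
its imaginary part a difference of two arguments. The bound does not depend on how close the path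
comes to 0. -/
theorem abs_im_integral_inv_le {w : ℂ} (hw : w.im ≠ 0) (a b : ℝ) :
    |(∫ x in a..b, ((x : ℂ) + w)⁻¹).im| ≤ 2 * Real.pi := by
  have e := integral_inv_add_mul (u := w) (v := 1) one_ne_zero (k := 1) (a := a) (b := b)
    (fun x _ => Or.inr (by simpa using hw))
  have : ∀ x : ℝ, (x + w : ℂ) = w + x * 1 := fun x => by ring
  simp only [this]
  rw [e, div_one, sub_im, log_im, log_im]
  refine (abs_sub _ _).trans ?_
  linarith [abs_arg_le_pi (1 * (w + b * 1)), abs_arg_le_pi (1 * (w + a * 1))]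

/-- Divide f by its zeros in the disc of radius 8/5. By Jensen there are O(log M) of them, and each
turns the argument by at most 2π. The cofactor has a logarithm on that disc whose real part is
bounded above by the maximum principle on radius 19/10, and Borel–Carathéodory bounds it at distance
3/2. The radii suit a centre on Re s = 2: the segment reaches Re s = 1/2 while the largest disc
stays in Re s ≥ 1/10. -/
theorem abs_im_integral_logDeriv_le_of_eq_one : ∃ K : ℝ, 0 < K ∧ ∀ (f : ℂ → ℂ) (c : ℂ) (M : ℝ),
    Differentiable ℂ f → f c = 1 → 1 ≤ M → (∀ z ∈ closedBall c (19 / 10), ‖f z‖ ≤ M) →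
    (∀ z ∈ closedBall c (8 / 5), f z = 0 → z.im ≠ c.im) →
    |(∫ x in (-(3 / 2) : ℝ)..0, logDeriv f (c + x)).im| ≤ K * (1 + Real.log M) := by
  set lam := Real.log ((19 / 10 : ℝ) / (8 / 5)) with hlam
  have hlam0 : 0 < lam := Real.log_pos (by norm_num)
  have hl6 : 0 < Real.log (16 / 3) := Real.log_pos (by norm_num)
  refine ⟨2 * Real.pi / lam + 30 * (1 + Real.log (16 / 3) / lam), by positivity, ?_⟩
  intro f c M hf hc hM hb him
  obtain ⟨S, hS, hn⟩ := exists_zeros_closedBall hf hc (r := 8 / 5) (by norm_num) (by norm_num) hM hb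
  have hne := analyticOrderAt_ne_top_of_differentiable hf (c := c) (by simp [hc])
  obtain ⟨g, hg, hgS, hfg⟩ := exists_eq_prod_pow_mul_of_differentiable hf hne S
  set m := analyticOrderNatAt f
  set n := ∑ ρ ∈ S, m ρ with hnd
  have hn' : (n : ℝ) ≤ Real.log M / lam := by rw [hnd]; push_cast; exact hn
  have hlogM : 0 ≤ Real.log M := Real.log_nonneg hM
  have hg0 : ∀ z ∈ closedBall c (8 / 5 : ℝ), g z ≠ 0 := fun z hz h0 =>
    hgS z ((hS z).2 ⟨hz, by rw [hfg, h0, mul_zero]⟩) h0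
  have hgc : g c ≠ 0 := hg0 c (mem_closedBall_self (by norm_num))
  obtain ⟨l, hl0, hl, hle⟩ := exists_log_ball hg (c := c) (r := 8 / 5) (by norm_num)
    fun z hz => hg0 z (ball_subset_closedBall hz)
  have hPc : ∏ ρ ∈ S, ‖c - ρ‖ ^ m ρ ≤ (8 / 5 : ℝ) ^ n := by
    rw [hnd, ← Finset.prod_pow_eq_pow_sum]
    refine Finset.prod_le_prod (fun _ _ => by positivity) fun ρ hρ => ?_
    have := ((hS ρ).1 hρ).1
    rw [mem_closedBall, dist_comm, dist_eq_norm] at this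
    gcongr
  have hgc1 : 1 ≤ (8 / 5 : ℝ) ^ n * ‖g c‖ := by
    have h1 : ‖f c‖ = (∏ ρ ∈ S, ‖c - ρ‖ ^ m ρ) * ‖g c‖ := by
      rw [hfg c, norm_mul, norm_prod]; simp only [norm_pow]
    rw [hc, norm_one] at h1
    rw [h1]
    gcongr
  have hsph : ∀ z ∈ sphere c (19 / 10 : ℝ), ‖g z‖ ≤ M * (10 / 3) ^ n := by
    intro z hz
    have hP : (3 / 10 : ℝ) ^ n ≤ ∏ ρ ∈ S, ‖z - ρ‖ ^ m ρ := by
      rw [hnd, ← Finset.prod_pow_eq_pow_sum]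
      refine Finset.prod_le_prod (fun _ _ => by positivity) fun ρ hρ => ?_
      have h1 := ((hS ρ).1 hρ).1
      rw [mem_closedBall, dist_eq_norm] at h1
      rw [mem_sphere, dist_eq_norm] at hz
      have : ‖z - c‖ ≤ ‖z - ρ‖ + ‖ρ - c‖ := norm_sub_le_norm_sub_add_norm_sub _ _ _
      gcongr
      linarith
    have h1 : ‖f z‖ = (∏ ρ ∈ S, ‖z - ρ‖ ^ m ρ) * ‖g z‖ := by
      rw [hfg z, norm_mul, norm_prod]; simp only [norm_pow]
    have h2 : (3 / 10 : ℝ) ^ n * ‖g z‖ ≤ M :=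
      le_trans (by rw [h1]; gcongr) (hb z (sphere_subset_closedBall hz))
    have h3 : (10 / 3 : ℝ) ^ n * (3 / 10) ^ n = 1 := by rw [← mul_pow]; norm_num
    calc ‖g z‖ = (10 / 3 : ℝ) ^ n * ((3 / 10) ^ n * ‖g z‖) := by rw [← mul_assoc, h3, one_mul]
      _ ≤ (10 / 3 : ℝ) ^ n * M := by gcongr
      _ = _ := mul_comm _ _
  have hball : ∀ z ∈ ball c (8 / 5 : ℝ), ‖g z‖ ≤ M * (10 / 3) ^ n := fun z hz =>
    norm_le_of_forall_mem_frontier_norm_le (U := ball c (19 / 10 : ℝ)) isBounded_ball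
      hg.diffContOnCl (by rw [frontier_ball c (by norm_num)]; exact hsph)
      (subset_closure (ball_subset_ball (by norm_num) hz))
  -- Each zero costs 16/3 = (10/3)(8/5): |z − ρ| ≥ 3/10 on the outer circle bounds g from above, and
  -- |c − ρ| ≤ 8/5 bounds g(c) from below.
  set B := Real.log M + n * Real.log (16 / 3) with hB
  have hB0 : 0 ≤ B := by positivity
  -- Borel–Carathéodory is applied with a strictly positive bound, and B may be 0; hence B + 1.
  have hre : ∀ z ∈ ball c (8 / 5 : ℝ), (l z).re ≤ B + 1 := by
    intro z hz
    have h1 : Real.exp (l z).re ≤ M * (16 / 3) ^ n := by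
      rw [← norm_exp, hle z hz, norm_div, div_le_iff₀ (norm_pos_iff.2 hgc)]
      calc ‖g z‖ ≤ M * (10 / 3) ^ n * 1 := by rw [mul_one]; exact hball z hz
        _ ≤ M * (10 / 3) ^ n * ((8 / 5 : ℝ) ^ n * ‖g c‖) := by gcongr
        _ = M * ((10 / 3) ^ n * (8 / 5 : ℝ) ^ n) * ‖g c‖ := by ring
        _ = _ := by rw [← mul_pow]; norm_num
    have h2 : M * (16 / 3) ^ n = Real.exp B := by
      rw [hB, Real.exp_add, Real.exp_log (by linarith), mul_comm (n : ℝ), Real.exp_mul,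
        Real.exp_log (by norm_num), Real.rpow_natCast]
    rw [h2, Real.exp_le_exp] at h1
    linarith
  have hmaps : ∀ w ∈ ball (0 : ℂ) (8 / 5), c + w ∈ ball c (8 / 5 : ℝ) := by
    intro w hw
    simpa [dist_eq_norm] using hw
  have hBC := borelCaratheodory_zero (M := B + 1) (f := fun w => l (c + w)) (R := 8 / 5)
    (z := (-(3 / 2) : ℝ)) (by linarith)
    (fun w hw => ((hl _ (hmaps w hw)).differentiableAt.comp w
      (by fun_prop)).differentiableWithinAt)
    (fun w hw => hre _ (hmaps w hw)) (by norm_num)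
    (by rw [mem_ball_zero_iff, norm_real]; norm_num [abs_of_pos]) (by simpa using hl0)
  have hnorm : ‖((-(3 / 2) : ℝ) : ℂ)‖ = 3 / 2 := by rw [norm_real]; norm_num [abs_of_pos]
  rw [hnorm] at hBC
  have hseg : ∀ x ∈ uIcc (-(3 / 2) : ℝ) 0, c + (x : ℂ) ∈ ball c (8 / 5 : ℝ) := by
    intro x hx
    rw [uIcc_of_le (by norm_num)] at hx
    apply hmaps
    rw [mem_ball_zero_iff, norm_real, Real.norm_eq_abs, abs_lt]
    constructor <;> linarith [hx.1, hx.2]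
  have hsegS : ∀ x : ℝ, ∀ ρ ∈ S, c + (x : ℂ) ≠ ρ := by
    rintro x ρ hρ rfl
    have := (hS _).1 hρ
    exact him _ this.1 this.2 (by simp)
  have i1 : ∀ ρ ∈ S, IntervalIntegrable
      (fun x : ℝ => (m ρ : ℂ) * (c + x - ρ)⁻¹) volume (-(3 / 2)) 0 := by
    intro ρ hρ
    refine ContinuousOn.intervalIntegrable (continuousOn_const.mul
      (ContinuousOn.inv₀ (by fun_prop) fun x h => sub_ne_zero.2 (hsegS x ρ hρ)))
  have hderiv : ∀ x ∈ uIcc (-(3 / 2) : ℝ) 0,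
      HasDerivAt (fun x : ℝ => l (c + x)) (logDeriv g (c + x)) x := by
    intro x hx
    have h2 : HasDerivAt (fun w : ℂ => l (c + w)) (logDeriv g (c + x)) (x : ℂ) := by
      simpa using (hl _ (hseg x hx)).comp_const_add c (x : ℂ)
    exact h2.comp_ofReal
  have hcont : ContinuousOn (fun x : ℝ => logDeriv g (c + x)) (uIcc (-(3 / 2) : ℝ) 0) := by
    intro x hx
    refine ContinuousAt.continuousWithinAt ?_
    have h1 : ContinuousAt (logDeriv g) (c + x) :=
      ((hg.deriv _).div (hg _) (hg0 _ (ball_subset_closedBall (hseg x hx)))).continuousAt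
    exact h1.comp (f := fun x : ℝ => c + (x : ℂ)) (by fun_prop)
  have hint : ∫ x in (-(3 / 2) : ℝ)..0, logDeriv f (c + x) =
      ∑ ρ ∈ S, (m ρ : ℂ) * (∫ x in (-(3 / 2) : ℝ)..0, ((x : ℂ) + (c - ρ))⁻¹) -
        l (c + (-(3 / 2) : ℝ)) := by
    rw [intervalIntegral.integral_congr (g := fun x : ℝ =>
        ∑ ρ ∈ S, (m ρ : ℂ) * (c + x - ρ)⁻¹ + logDeriv g (c + x)),
      intervalIntegral.integral_add, intervalIntegral.integral_finsetSum i1]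
    · simp only [intervalIntegral.integral_const_mul]
      rw [intervalIntegral.integral_eq_sub_of_hasDerivAt hderiv hcont.intervalIntegrable]
      simp only [ofReal_zero, add_zero, hl0, zero_sub, ← sub_eq_add_neg]
      congr 1
      refine Finset.sum_congr rfl fun ρ _ => ?_
      congr 2
      ext x
      ring
    · simpa only [Finset.sum_fn] using IntervalIntegrable.sum S i1
    · exact hcont.intervalIntegrable
    · intro x h
      exact logDeriv_eq_sum_add hg hfg (fun h' => hsegS x _ h' rfl)
        (hg0 _ (ball_subset_closedBall (hseg x h)))
  rw [hint, sub_im, im_sum]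
  have h1 : |∑ ρ ∈ S, ((m ρ : ℂ) * (∫ x in (-(3 / 2) : ℝ)..0, ((x : ℂ) + (c - ρ))⁻¹)).im| ≤
      n * (2 * Real.pi) := by
    rw [hnd, Nat.cast_sum, Finset.sum_mul]
    refine (Finset.abs_sum_le_sum_abs _ _).trans (Finset.sum_le_sum fun ρ hρ => ?_)
    rw [← ofReal_natCast, im_ofReal_mul, abs_mul, Nat.abs_cast]
    gcongr
    have := (hS _).1 hρ
    exact abs_im_integral_inv_le (by simpa [sub_eq_zero] using (him _ this.1 this.2).symm) _ _
  -- 30 = 2r/(R − r) with r = 3/2 and R = 8/5.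
  have h2 : |(l (c + (-(3 / 2) : ℝ))).im| ≤ 30 * (B + 1) :=
    (abs_im_le_norm _).trans (hBC.trans (le_of_eq (by ring)))
  refine (abs_sub _ _).trans ((add_le_add h1 h2).trans ?_)
  have h3 : (n : ℝ) * (2 * Real.pi) ≤ Real.log M / lam * (2 * Real.pi) := by gcongr
  have h4 : (n : ℝ) * Real.log (16 / 3) ≤ Real.log M / lam * Real.log (16 / 3) := by gcongr
  have e : (2 * Real.pi / lam + 30 * (1 + Real.log (16 / 3) / lam)) * (1 + Real.log M) =
      Real.log M / lam * (2 * Real.pi) + 30 * (Real.log M + Real.log M / lam * Real.log (16 / 3) + 1)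
        + (2 * Real.pi / lam + 30 * (Real.log (16 / 3) / lam)) := by
    ring
  have e2 : 0 ≤ 2 * Real.pi / lam + 30 * (Real.log (16 / 3) / lam) := by positivity
  rw [e, hB]
  linarith

/-- The variation of the argument of an entire function along a horizontal segment is bounded by
the logarithm of its growth nearby. -/
theorem abs_im_integral_logDeriv_le : ∃ K : ℝ, 0 < K ∧ ∀ (f : ℂ → ℂ) (c : ℂ) (M : ℝ),
    Differentiable ℂ f → f c ≠ 0 → 1 ≤ M →
    (∀ z ∈ closedBall c (19 / 10), ‖f z‖ ≤ M * ‖f c‖) →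
    (∀ z ∈ closedBall c (8 / 5), f z = 0 → z.im ≠ c.im) →
    |(∫ x in (-(3 / 2) : ℝ)..0, logDeriv f (c + x)).im| ≤ K * (1 + Real.log M) := by
  obtain ⟨K, hK, h⟩ := abs_im_integral_logDeriv_le_of_eq_one
  refine ⟨K, hK, fun f c M hf hc hM hb him => ?_⟩
  have := h (fun z => (f c)⁻¹ * f z) c M (hf.const_mul _) (inv_mul_cancel₀ hc) hM
    (fun z hz => by
      rw [norm_mul, norm_inv, inv_mul_le_iff₀ (norm_pos_iff.2 hc), mul_comm]
      exact hb z hz)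
    (fun z hz h0 => him z hz (by simpa [hc] using h0))
  simpa only [logDeriv_const_mul _ _ (inv_ne_zero hc)] using this

end HorizontalVariation

/-! ### Growth of (s − 1)ζ(s) to the right of the imaginary axis, and ζ on Re s = 2. -/

section ZetaGrowth

open Complex

/-- The terms of the series `∑ₙ ((s - 1) n⁻ˢ - n¹⁻ˢ + (n + 1)¹⁻ˢ) = (s - 1) ζ(s) - 1`. -/
noncomputable def zetaTerm (n : ℕ) (s : ℂ) : ℂ :=
  (s - 1) * ((n + 1 : ℝ) : ℂ) ^ (-s) - ((n + 1 : ℝ) : ℂ) ^ (1 - s) + ((n + 2 : ℝ) : ℂ) ^ (1 - s)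

/-- With a = n + 1, the term is the increment over [a, a + 1] of x^(1−s) + (s − 1)a^(−s)x, whose
derivative is (1 − s)(x^(−s) − a^(−s)). Two uses of the mean value inequality give the two factors
‖s − 1‖ and ‖s‖ and the exponent −(σ + 1). -/
theorem norm_zetaTerm_le (n : ℕ) {s : ℂ} {σ : ℝ} (hσ : 0 < σ) (hs : σ ≤ s.re) :
    ‖zetaTerm n s‖ ≤ ‖s - 1‖ * ‖s‖ * (n + 1 : ℝ) ^ (-(σ + 1)) := by
  set a : ℝ := n + 1 with ha
  have ha1 : 1 ≤ a := by rw [ha]; linarith [n.cast_nonneg (α := ℝ)]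
  set J := Icc a (a + 1)
  have hpos : ∀ x ∈ J, 0 < x := fun x hx => by linarith [hx.1]
  have hd : ∀ x ∈ J, ∀ r : ℂ, r ≠ 0 →
      HasDerivAt (fun x : ℝ => (x : ℂ) ^ r) (r * (x : ℂ) ^ (r - 1)) x :=
    fun x hx r hr => hasDerivAt_ofReal_cpow_const (hpos x hx).ne' hr
  have hs0 : s ≠ 0 := by rintro rfl; simp at hs; linarith
  have hb1 : ∀ x ∈ J, ‖(-s) * (x : ℂ) ^ (-s - 1)‖ ≤ ‖s‖ * a ^ (-(σ + 1)) := by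
    intro x hx
    rw [norm_mul, norm_neg, norm_cpow_eq_rpow_re_of_pos (hpos x hx)]
    gcongr
    calc x ^ (-s - 1).re ≤ x ^ (-(σ + 1)) :=
          Real.rpow_le_rpow_of_exponent_le (ha1.trans hx.1) (by simp; linarith)
      _ ≤ a ^ (-(σ + 1)) :=
          Real.rpow_le_rpow_of_nonpos (by linarith) hx.1 (by linarith)
  have haJ : a ∈ J := ⟨le_rfl, by linarith⟩
  have hv : ∀ x ∈ J, ‖(x : ℂ) ^ (-s) - (a : ℂ) ^ (-s)‖ ≤ ‖s‖ * a ^ (-(σ + 1)) := by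
    intro x hx
    refine ((convex_Icc a (a + 1)).norm_image_sub_le_of_norm_hasDerivWithin_le
      (fun y hy => (hd y hy (-s) (neg_ne_zero.2 hs0)).hasDerivWithinAt) hb1 haJ hx).trans ?_
    have : ‖x - a‖ ≤ 1 := by
      rw [Real.norm_eq_abs, abs_le]; constructor <;> linarith [hx.1, hx.2]
    exact mul_le_of_le_one_right (by positivity) this
  by_cases h1 : s = 1
  · simp [zetaTerm, h1]
  have hd2 : ∀ x ∈ J, HasDerivWithinAt
      (fun x : ℝ => (x : ℂ) ^ (1 - s) + (s - 1) * (a : ℂ) ^ (-s) * x)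
      ((1 - s) * ((x : ℂ) ^ (-s) - (a : ℂ) ^ (-s))) J x := by
    intro x hx
    have e1 := hd x hx (1 - s) (sub_ne_zero.2 (Ne.symm h1))
    have e2 : HasDerivAt (fun x : ℝ => (s - 1) * (a : ℂ) ^ (-s) * x)
        ((s - 1) * (a : ℂ) ^ (-s) * 1) x := ofRealCLM.hasDerivAt.const_mul _
    refine HasDerivAt.hasDerivWithinAt ?_
    convert! e1.add e2 using 1
    rw [show 1 - s - 1 = -s by ring]
    ring
  have := (convex_Icc a (a + 1)).norm_image_sub_le_of_norm_hasDerivWithin_le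
    (C := ‖s - 1‖ * (‖s‖ * a ^ (-(σ + 1)))) hd2 (fun x hx => by
      rw [norm_mul, norm_sub_rev 1 s]
      gcongr
      exact hv x hx) haJ (y := a + 1) ⟨by linarith, le_rfl⟩
  rw [add_sub_cancel_left, norm_one, mul_one, ← mul_assoc] at this
  refine le_trans (le_of_eq ?_) this
  rw [zetaTerm, show (n + 2 : ℝ) = a + 1 by rw [ha]; ring, ← ha]
  congr 1
  push_cast
  ring

theorem summable_nat_add_one_rpow {σ : ℝ} (hσ : 0 < σ) :
    Summable fun n : ℕ => (n + 1 : ℝ) ^ (-(σ + 1)) := by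
  have := (summable_nat_add_iff 1).2 (Real.summable_nat_rpow.2 (by linarith : -(σ + 1) < -1))
  simpa using this

theorem summable_zetaTerm {s : ℂ} (hs : 0 < s.re) : Summable fun n => zetaTerm n s :=
  Summable.of_norm_bounded ((summable_nat_add_one_rpow hs).mul_left _)
    fun n => norm_zetaTerm_le n hs le_rfl

theorem differentiable_zetaTerm (n : ℕ) : Differentiable ℂ (zetaTerm n) := by
  have h : ∀ a : ℝ, 0 < a → (a : ℂ) ≠ 0 := fun a ha => by exact_mod_cast ha.ne'
  have h1 := h (n + 1) (by positivity)
  have h2 := h (n + 2) (by positivity)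
  intro s
  refine ((DifferentiableAt.mul (by fun_prop) ?_).sub ?_).add ?_
  · exact DifferentiableAt.const_cpow (by fun_prop) (Or.inl h1)
  · exact DifferentiableAt.const_cpow (by fun_prop) (Or.inl h1)
  · exact DifferentiableAt.const_cpow (by fun_prop) (Or.inl h2)

/-- The differences of the powers with exponent 1 − s telescope to −1, since these powers tend to 0
for Re s > 1; the rest is (s − 1) times the zeta series. -/
theorem tsum_zetaTerm_of_one_lt_re {s : ℂ} (hs : 1 < s.re) :
    1 + ∑' n, zetaTerm n s = riemannZeta₁ s := by
  have hs1 : s ≠ 1 := by rintro rfl; simp at hs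
  have hz : HasSum (fun n : ℕ => ((n + 1 : ℝ) : ℂ) ^ (-s)) (riemannZeta s) := by
    rw [zeta_eq_tsum_one_div_nat_add_one_cpow hs]
    have := ((summable_nat_add_iff 1).2 (summable_one_div_nat_cpow.2 hs)).hasSum
    convert! this using 2 with n
    · push_cast
      rw [cpow_neg, one_div]
    · push_cast; rfl
  have hpart : ∀ N : ℕ, ∑ n ∈ Finset.range N, zetaTerm n s =
      (s - 1) * ∑ n ∈ Finset.range N, ((n + 1 : ℝ) : ℂ) ^ (-s) +
        (((N + 1 : ℝ) : ℂ) ^ (1 - s) - 1) := by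
    intro N
    induction N with
    | zero => simp
    | succ N ih =>
      rw [Finset.sum_range_succ, Finset.sum_range_succ, ih, zetaTerm,
        show ((N + 1 : ℕ) : ℝ) + 1 = N + 2 by push_cast; ring]
      ring
  have hlim0 : Tendsto (fun N : ℕ => ((N + 1 : ℝ) : ℂ) ^ (1 - s)) atTop (𝓝 0) := by
    rw [tendsto_zero_iff_norm_tendsto_zero]
    have h1 : Tendsto (fun N : ℕ => (N + 1 : ℝ) ^ (-(s.re - 1))) atTop (𝓝 0) :=
      (tendsto_rpow_neg_atTop (by linarith)).comp
        (tendsto_atTop_add_const_right _ _ tendsto_natCast_atTop_atTop)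
    refine h1.congr fun N => ?_
    rw [norm_cpow_eq_rpow_re_of_pos (by positivity)]
    simp
  have hlim : Tendsto (fun N : ℕ => ∑ n ∈ Finset.range N, zetaTerm n s) atTop
      (𝓝 ((s - 1) * riemannZeta s + (0 - 1))) := by
    simp only [hpart]
    exact (hz.tendsto_sum_nat.const_mul _).add (hlim0.sub_const 1)
  rw [tendsto_nhds_unique (summable_zetaTerm (by linarith)).hasSum.tendsto_sum_nat hlim,
    riemannZeta_eq_inv_sub_mul hs1]
  have := sub_ne_zero.2 hs1
  field_simp
  ring

theorem differentiableOn_tsum_zetaTerm :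
    DifferentiableOn ℂ (fun s => 1 + ∑' n, zetaTerm n s) {s : ℂ | 0 < s.re} := by
  intro s hs
  have hs : 0 < s.re := hs
  set U := {w : ℂ | s.re / 2 < w.re} ∩ Metric.ball 0 (‖s‖ + 1) with hU
  have hUo : IsOpen U := (isOpen_lt continuous_const continuous_re).inter Metric.isOpen_ball
  have hsU : s ∈ U := ⟨by change s.re / 2 < s.re; linarith, by simp⟩
  have : DifferentiableOn ℂ (fun w => ∑' n, zetaTerm n w) U := by
    refine differentiableOn_tsum_of_summable_norm
      (u := fun n : ℕ => (‖s‖ + 2) * (‖s‖ + 1) * (n + 1 : ℝ) ^ (-(s.re / 2 + 1)))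
      ((summable_nat_add_one_rpow (by linarith)).mul_left _)
      (fun n => (differentiable_zetaTerm n).differentiableOn) hUo ?_
    rintro n w ⟨hw1, hw2⟩
    have hw2' : ‖w‖ < ‖s‖ + 1 := by simpa using hw2
    refine (norm_zetaTerm_le n (by linarith : 0 < s.re / 2) (le_of_lt hw1)).trans ?_
    have : ‖w - 1‖ ≤ ‖s‖ + 2 := (norm_sub_le _ _).trans (by rw [norm_one]; linarith)
    gcongr
  exact ((this.differentiableAt (hUo.mem_nhds hsU)).const_add 1).differentiableWithinAt

/-- Both sides are analytic on the right half plane, so the identity theorem extends the equality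
from Re s > 1. -/
theorem riemannZeta₁_eq_tsum {s : ℂ} (hs : 0 < s.re) :
    riemannZeta₁ s = 1 + ∑' n, zetaTerm n s := by
  have hH : IsOpen {s : ℂ | 0 < s.re} := isOpen_lt continuous_const continuous_re
  have h1 : AnalyticOnNhd ℂ (fun s => 1 + ∑' n, zetaTerm n s) {s : ℂ | 0 < s.re} :=
    differentiableOn_tsum_zetaTerm.analyticOnNhd hH
  have h2 : AnalyticOnNhd ℂ riemannZeta₁ {s : ℂ | 0 < s.re} :=
    differentiable_riemannZeta₁.differentiableOn.analyticOnNhd hH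
  refine h2.eqOn_of_preconnected_of_eventuallyEq h1 (convex_halfSpace_re_gt 0).isPreconnected
    (z₀ := 2) (by simp) ?_ hs
  filter_upwards [(isOpen_lt continuous_const continuous_re).mem_nhds
    (show (2 : ℂ) ∈ {s : ℂ | 1 < s.re} by simp)] with s hs
  exact (tsum_zetaTerm_of_one_lt_re hs).symm

theorem norm_riemannZeta₁_le {σ : ℝ} (hσ : 0 < σ) : ∃ C : ℝ, 0 < C ∧ ∀ s : ℂ, σ ≤ s.re →
    ‖riemannZeta₁ s‖ ≤ C * (1 + ‖s‖) ^ 2 := by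
  set A := ∑' n : ℕ, (n + 1 : ℝ) ^ (-(σ + 1))
  have hA : 0 ≤ A := tsum_nonneg fun n => by positivity
  refine ⟨1 + A, by linarith, fun s hs => ?_⟩
  rw [riemannZeta₁_eq_tsum (hσ.trans_le hs)]
  have h1 : ‖∑' n, zetaTerm n s‖ ≤ ‖s - 1‖ * ‖s‖ * A :=
    tsum_of_norm_bounded ((summable_nat_add_one_rpow hσ).hasSum.mul_left _)
      fun n => norm_zetaTerm_le n hσ hs
  have h2 : ‖s - 1‖ ≤ 1 + ‖s‖ := (norm_sub_le _ _).trans (by rw [norm_one]; linarith)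
  calc ‖1 + ∑' n, zetaTerm n s‖ ≤ 1 + ‖s - 1‖ * ‖s‖ * A :=
        (norm_add_le _ _).trans (by rw [norm_one]; linarith)
    _ ≤ (1 + ‖s‖) ^ 2 + (1 + ‖s‖) * (1 + ‖s‖) * A := by
        gcongr
        · nlinarith [norm_nonneg s]
        · linarith
    _ = _ := by ring

/-- The series from n = 2 on is dominated by ζ(2) − 1 = π²/6 − 1. What matters is that the constant
is below 1: it keeps ζ in the right half plane and away from 0. -/
theorem norm_riemannZeta_sub_one_le {s : ℂ} (hs : s.re = 2) : ‖riemannZeta s - 1‖ ≤ 13 / 20 := by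
  have hs1 : 1 < s.re := by rw [hs]; norm_num
  have hsum := (summable_nat_add_iff 1).2 (summable_one_div_nat_cpow.2 hs1)
  have h2 := hasSum_zeta_two
  have h2' : HasSum (fun n : ℕ => 1 / ((n + 2 : ℕ) : ℝ) ^ 2) (Real.pi ^ 2 / 6 - 1) := by
    have := (hasSum_nat_add_iff' 2).2 h2
    simpa [Finset.sum_range_succ] using this
  have e : riemannZeta s - 1 = ∑' n : ℕ, 1 / ((n + 2 : ℕ) : ℂ) ^ s := by
    rw [zeta_eq_tsum_one_div_nat_cpow hs1,
      ← (summable_one_div_nat_cpow.2 hs1).sum_add_tsum_nat_add 2]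
    have : s ≠ 0 := by rintro rfl; simp at hs
    simp [Finset.sum_range_succ, this]
  rw [e]
  refine (tsum_of_norm_bounded h2' fun n => le_of_eq ?_).trans ?_
  · rw [norm_div, norm_one, norm_natCast_cpow_of_pos (by omega), hs]
    norm_num
  · have := Real.pi_lt_d4
    nlinarith [Real.pi_pos]

theorem re_riemannZeta_pos {s : ℂ} (hs : s.re = 2) : 0 < (riemannZeta s).re := by
  have h := (abs_re_le_norm _).trans (norm_riemannZeta_sub_one_le hs)
  rw [sub_re, one_re, abs_le] at h
  linarith [h.1]

theorem norm_riemannZeta_ge {s : ℂ} (hs : s.re = 2) : 7 / 20 ≤ ‖riemannZeta s‖ := by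
  have h := (abs_re_le_norm _).trans (norm_riemannZeta_sub_one_le hs)
  rw [sub_re, one_re, abs_le] at h
  exact le_trans (by linarith [h.1]) (re_le_norm _)

end ZetaGrowth

/-! ### A holomorphic log Γ and Stirling's formula for its imaginary part. -/

section LogGamma

open Complex

/-- The terms of a series for the logarithm of the Gamma function. -/
noncomputable def logGammaTerm (n : ℕ) (s : ℂ) : ℂ :=
  s * ((Real.log (n + 2) - Real.log (n + 1) : ℝ) : ℂ) + (Real.log (n + 2) : ℂ) - log (s + (n + 2))

/-- The holomorphic logarithm of the Gamma function on the right half plane that is real on the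
positive real axis. -/
noncomputable def logGamma (s : ℂ) : ℂ :=
  -log s - log (s + 1) + ∑' n, logGammaTerm n s

theorem abs_log_sub_log_sub_inv_le (n : ℕ) :
    |Real.log (n + 2) - Real.log (n + 1) - ((n : ℝ) + 2)⁻¹| ≤ 1 / ((n + 1) * (n + 2)) := by
  have h1 : (0 : ℝ) < n + 1 := by positivity
  have h2 : (0 : ℝ) < n + 2 := by positivity
  have e1 := Real.log_le_sub_one_of_pos (div_pos h2 h1)
  have e2 := Real.one_sub_inv_le_log_of_pos (div_pos h2 h1)
  rw [Real.log_div h2.ne' h1.ne'] at e1 e2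
  have d1 : ((n : ℝ) + 2) / (n + 1) - 1 = (n + 2 : ℝ)⁻¹ + 1 / ((n + 1) * (n + 2)) := by
    field_simp; ring
  have d2 : 1 - (((n : ℝ) + 2) / (n + 1))⁻¹ = (n + 2 : ℝ)⁻¹ := by
    field_simp; ring
  rw [abs_le]
  have : (0 : ℝ) ≤ 1 / ((n + 1) * (n + 2)) := by positivity
  constructor <;> linarith

theorem add_mem_slitPlane {s : ℂ} (hs : 0 ≤ s.re) {x : ℝ} (hx : 0 < x) : s + x ∈ slitPlane :=
  Or.inl (by simp; linarith)

/-- The term vanishes at 0, and its derivative log((n + 2)/(n + 1)) − 1/(w + n + 2) is O((1 +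
‖s‖)/(n + 1)²) on the convex half disc Re w ≥ 0, ‖w‖ ≤ ‖s‖. -/
theorem norm_logGammaTerm_le (n : ℕ) {s : ℂ} (hs : 0 ≤ s.re) :
    ‖logGammaTerm n s‖ ≤ ‖s‖ * (1 + ‖s‖) * (1 / (n + 1) ^ 2) := by
  set D : Set ℂ := {w | 0 ≤ w.re} ∩ Metric.closedBall 0 ‖s‖
  have hD : Convex ℝ D := (convex_halfSpace_re_ge 0).inter (convex_closedBall _ _)
  have h2 : (0 : ℝ) < n + 2 := by positivity
  have hsl : ∀ w ∈ D, w + (n + 2 : ℂ) ∈ slitPlane := by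
    intro w hw
    have := add_mem_slitPlane hw.1 h2
    push_cast at this
    exact this
  have hd : ∀ w ∈ D, HasDerivWithinAt (logGammaTerm n)
      (((Real.log (n + 2) - Real.log (n + 1) : ℝ) : ℂ) - (w + (n + 2))⁻¹) D w := by
    intro w hw
    refine HasDerivAt.hasDerivWithinAt ?_
    have h3 := ((hasDerivAt_id w).add_const (n + 2 : ℂ)).clog (hsl w hw)
    convert! (((hasDerivAt_id w).mul_const
      ((Real.log (n + 2) - Real.log (n + 1) : ℝ) : ℂ)).add_const
      (Real.log (n + 2) : ℂ)).sub h3 using 1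
    simp
  have hb : ∀ w ∈ D, ‖((Real.log (n + 2) - Real.log (n + 1) : ℝ) : ℂ) - (w + (n + 2))⁻¹‖ ≤
      (1 + ‖s‖) * (1 / (n + 1) ^ 2) := by
    intro w hw
    have hw2 : ‖w‖ ≤ ‖s‖ := by simpa using hw.2
    have hn2 : ((n : ℂ) + 2) ≠ 0 := by exact_mod_cast h2.ne'
    have hw0 := slitPlane_ne_zero (hsl w hw)
    have e : ((Real.log (n + 2) - Real.log (n + 1) : ℝ) : ℂ) - (w + (n + 2))⁻¹ =
        ((Real.log (n + 2) - Real.log (n + 1) - ((n : ℝ) + 2)⁻¹ : ℝ) : ℂ) +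
          w / ((n + 2) * (w + (n + 2))) := by
      push_cast
      field_simp
      ring
    have hlow : (n + 2 : ℝ) ≤ ‖w + (n + 2)‖ := by
      refine le_trans ?_ (re_le_norm _)
      have : 0 ≤ w.re := hw.1
      simp [this]
    have hn2' : ‖(n + 2 : ℂ)‖ = n + 2 := by
      rw [show (n + 2 : ℂ) = ((n + 2 : ℝ) : ℂ) by push_cast; rfl, norm_real, Real.norm_eq_abs,
        abs_of_pos h2]
    rw [e]
    refine (norm_add_le _ _).trans ?_
    rw [norm_real, Real.norm_eq_abs, norm_div, norm_mul, hn2']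
    have t1 := abs_log_sub_log_sub_inv_le n
    have t2 : 1 / (((n : ℝ) + 1) * (n + 2)) ≤ 1 / (n + 1) ^ 2 := by
      rw [sq]; gcongr; norm_num
    have t3 : ‖w‖ / ((n + 2) * ‖w + (n + 2)‖) ≤ ‖s‖ / (n + 1) ^ 2 := by
      rw [sq]; gcongr <;> linarith
    have t4 : (1 + ‖s‖) * (1 / ((n : ℝ) + 1) ^ 2) = 1 / (n + 1) ^ 2 + ‖s‖ / (n + 1) ^ 2 := by ring
    linarith
  have h0 : logGammaTerm n 0 = 0 := by
    rw [logGammaTerm, zero_mul, zero_add, zero_add, ofReal_log h2.le]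
    push_cast
    ring
  have := hD.norm_image_sub_le_of_norm_hasDerivWithin_le hd hb (x := 0) (y := s)
    ⟨by simp, by simp⟩ ⟨hs, by simp⟩
  rw [h0, sub_zero, sub_zero] at this
  linarith

theorem summable_one_div_nat_add_one_sq : Summable fun n : ℕ => (1 : ℝ) / (n + 1) ^ 2 := by
  have := (summable_nat_add_iff 1).2 (Real.summable_one_div_nat_pow.2 one_lt_two)
  simpa using this

/-- The terms telescope to a logarithm of Gauss's product m^s m!/(s(s + 1)⋯(s + m)) with m = N + 1;
the two logarithms outside the sum are its factors j = 0 and j = 1. -/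
theorem sum_logGammaTerm (s : ℂ) (N : ℕ) :
    -log s - log (s + 1) + ∑ n ∈ Finset.range N, logGammaTerm n s =
      s * (Real.log (N + 1) : ℂ) + (Real.log ((N + 1).factorial) : ℂ) -
        ∑ j ∈ Finset.range (N + 2), log (s + j) := by
  induction N with
  | zero => simp [Finset.sum_range_succ]; ring
  | succ N ih =>
    rw [Finset.sum_range_succ, ← add_assoc, ih, Finset.sum_range_succ _ (N + 2), logGammaTerm,
      Nat.factorial_succ (N + 1), Nat.cast_mul,
      Real.log_mul (by positivity) (by positivity)]
    push_cast
    rw [show (N : ℝ) + 1 + 1 = N + 2 by ring]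
    ring

theorem tendsto_sum_logGammaTerm {s : ℂ} (hs : 0 < s.re) :
    Tendsto (fun N : ℕ => s * (Real.log (N + 1) : ℂ) + (Real.log ((N + 1).factorial) : ℂ) -
        ∑ j ∈ Finset.range (N + 2), log (s + j)) atTop (𝓝 (logGamma s)) := by
  simp only [← sum_logGammaTerm]
  have : Summable fun n => logGammaTerm n s :=
    Summable.of_norm_bounded (summable_one_div_nat_add_one_sq.mul_left _)
      fun n => norm_logGammaTerm_le n hs.le
  exact this.hasSum.tendsto_sum_nat.const_add _

theorem exp_logGamma {s : ℂ} (hs : 0 < s.re) : exp (logGamma s) = Gamma s := by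
  have h1 := (continuous_exp.tendsto _).comp (tendsto_sum_logGammaTerm hs)
  -- The shift by one matches the partial sums, which give Gauss's product at N + 1.
  have h2 := (GammaSeq_tendsto_Gamma s).comp (tendsto_add_atTop_nat 1)
  refine tendsto_nhds_unique h1 (h2.congr fun N => ?_)
  have hj : ∀ j ∈ Finset.range (N + 2), exp (log (s + j)) = s + j := by
    intro j _
    refine exp_log fun h => ?_
    have := congrArg re h
    simp at this
    linarith [j.cast_nonneg (α := ℝ)]
  simp only [Function.comp, GammaSeq]
  rw [exp_sub, exp_add, exp_sum, Finset.prod_congr rfl hj, ← ofReal_exp,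
    Real.exp_log (by positivity), cpow_def_of_ne_zero (by exact_mod_cast N.succ_ne_zero),
    ← natCast_log]
  push_cast
  rw [mul_comm s]

theorem differentiableOn_logGamma : DifferentiableOn ℂ logGamma {s : ℂ | 0 < s.re} := by
  intro s hs
  have hs : 0 < s.re := hs
  set U := {w : ℂ | 0 < w.re} ∩ Metric.ball 0 (‖s‖ + 1) with hU
  have hUo : IsOpen U := (isOpen_lt continuous_const continuous_re).inter Metric.isOpen_ball
  have hsU : s ∈ U := ⟨hs, by simp⟩
  have h1 : DifferentiableOn ℂ (fun w => ∑' n, logGammaTerm n w) U := by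
    refine differentiableOn_tsum_of_summable_norm
      (u := fun n : ℕ => (‖s‖ + 1) * (1 + (‖s‖ + 1)) * (1 / (n + 1 : ℝ) ^ 2))
      (summable_one_div_nat_add_one_sq.mul_left _) ?_ hUo ?_
    · intro n w hw
      have hw1 : 0 < w.re := hw.1
      refine DifferentiableAt.differentiableWithinAt ?_
      unfold logGammaTerm
      refine DifferentiableAt.sub (by fun_prop) (DifferentiableAt.clog (by fun_prop) ?_)
      have := add_mem_slitPlane hw1.le (by positivity : (0 : ℝ) < n + 2)
      push_cast at this
      exact this
    · rintro n w ⟨hw1, hw2⟩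
      have hw2' : ‖w‖ < ‖s‖ + 1 := by simpa using hw2
      refine (norm_logGammaTerm_le n (le_of_lt hw1)).trans ?_
      gcongr
  refine DifferentiableAt.differentiableWithinAt (DifferentiableAt.add ?_
    (h1.differentiableAt (hUo.mem_nhds hsU)))
  refine DifferentiableAt.sub (DifferentiableAt.neg (DifferentiableAt.clog (by fun_prop) (Or.inl hs)))
    (DifferentiableAt.clog (by fun_prop) ?_)
  simpa using add_mem_slitPlane hs.le one_pos

theorem hasDerivAt_logGamma {s : ℂ} (hs : 0 < s.re) :
    HasDerivAt logGamma (logDeriv Gamma s) s := by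
  have hH : {s : ℂ | 0 < s.re} ∈ 𝓝 s := (isOpen_lt continuous_const continuous_re).mem_nhds hs
  have hd := (differentiableOn_logGamma.differentiableAt hH).hasDerivAt
  have he : (fun w => exp (logGamma w)) =ᶠ[𝓝 s] Gamma := by
    filter_upwards [hH] with w hw using exp_logGamma hw
  have : logDeriv Gamma s = deriv logGamma s := by
    rw [logDeriv_apply, ← he.deriv_eq, hd.cexp.deriv, ← exp_logGamma hs]
    field_simp
  rwa [this]

theorem arg_eq_arctan_of_re_pos {z : ℂ} (hz : 0 < z.re) : z.arg = Real.arctan (z.im / z.re) := by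
  have := abs_lt.1 (abs_arg_lt_pi_div_two_iff.2 (Or.inl hz))
  rw [← tan_arg, Real.arctan_tan this.1 this.2]

/-- The factorial term is real, and arg(a + j + it) = arctan(t/(a + j)). Stirling's formula thereby
becomes the comparison of a monotone sum with an integral. -/
theorem tendsto_im_logGamma {a : ℝ} (ha : 0 < a) (t : ℝ) :
    Tendsto (fun N : ℕ => t * Real.log (N + 1) -
        ∑ j ∈ Finset.range (N + 2), Real.arctan (t / (a + j))) atTop
      (𝓝 (logGamma (a + t * I)).im) := by
  have h := (continuous_im.tendsto _).comp (tendsto_sum_logGammaTerm (s := a + t * I) (by simpa))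
  refine h.congr fun N => ?_
  simp only [Function.comp, sub_im, add_im, im_mul_ofReal, ofReal_im, im_sum, log_im]
  congr 1
  · simp
  · refine Finset.sum_congr rfl fun j _ => ?_
    rw [arg_eq_arctan_of_re_pos (by simp; positivity)]
    simp

theorem im_logGamma_neg {a : ℝ} (ha : 0 < a) (t : ℝ) :
    (logGamma (a - t * I)).im = -(logGamma (a + t * I)).im := by
  have h1 := tendsto_im_logGamma ha (-t)
  have h2 := (tendsto_im_logGamma ha t).neg
  rw [show (a : ℂ) - t * I = a + (-t : ℝ) * I by push_cast; ring]
  refine tendsto_nhds_unique h1 (h2.congr fun N => ?_)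
  simp only [neg_div, Real.arctan_neg, Finset.sum_neg_distrib]
  ring

/-- For x > 0 the integrand is arctan(t/x), written in a form that is smooth at x = 0 as well. -/
theorem hasDerivAt_stirlingPrimitive {t : ℝ} (ht : 0 < t) (x : ℝ) :
    HasDerivAt (fun x => x * (Real.pi / 2 - Real.arctan (x / t)) + t / 2 * Real.log (t ^ 2 + x ^ 2))
      (Real.pi / 2 - Real.arctan (x / t)) x := by
  have h1 : HasDerivAt (fun x => Real.arctan (x / t)) (1 / (1 + (x / t) ^ 2) * (1 / t)) x :=
    ((hasDerivAt_id x).div_const t).arctan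
  have h2 : HasDerivAt (fun x => Real.log (t ^ 2 + x ^ 2)) ((2 * x) / (t ^ 2 + x ^ 2)) x := by
    have := ((hasDerivAt_pow 2 x).const_add (t ^ 2)).log (by positivity)
    simpa using this
  convert! ((hasDerivAt_id x).mul (h1.const_sub (Real.pi / 2))).add (h2.const_mul (t / 2)) using 1
  simp only [id]
  have : t ^ 2 + x ^ 2 ≠ 0 := by positivity
  field_simp
  ring

theorem tendsto_stirlingPrimitive {a t : ℝ} (ha : 0 < a) (ht : 0 < t) :
    Tendsto (fun N : ℕ => t * Real.log (N + 1) - ((a + (N + 2 : ℕ)) *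
      (Real.pi / 2 - Real.arctan ((a + (N + 2 : ℕ)) / t)) +
        t / 2 * Real.log (t ^ 2 + (a + (N + 2 : ℕ)) ^ 2))) atTop (𝓝 (-t)) := by
  have hX : Tendsto (fun N : ℕ => a + ((N + 2 : ℕ) : ℝ)) atTop atTop :=
    tendsto_atTop_add_const_left _ _ (tendsto_natCast_atTop_atTop.comp (tendsto_add_atTop_nat 2))
  have h1 : Tendsto (fun N : ℕ => (a + (N + 2 : ℕ)) *
      (Real.pi / 2 - Real.arctan ((a + (N + 2 : ℕ)) / t))) atTop (𝓝 t) := by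
    -- X · arctan(t/X) is the difference quotient of h ↦ arctan(th) at 0 with h = 1/X, so it tends
    -- to t.
    have hd : HasDerivAt (fun h => Real.arctan (t * h)) t 0 := by
      have := ((hasDerivAt_id (0 : ℝ)).const_mul t).arctan
      simpa using this
    have hY : Tendsto (fun N : ℕ => (a + ((N + 2 : ℕ) : ℝ))⁻¹) atTop (𝓝[≠] 0) := by
      refine tendsto_nhdsWithin_iff.2 ⟨tendsto_inv_atTop_zero.comp hX, Eventually.of_forall fun N => ?_⟩
      have : a + ((N + 2 : ℕ) : ℝ) ≠ 0 := by positivity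
      exact inv_ne_zero this
    refine (hd.tendsto_slope_zero.comp hY).congr fun N => ?_
    have hp : 0 < a + ((N + 2 : ℕ) : ℝ) := by positivity
    simp only [Function.comp, zero_add, mul_zero, Real.arctan_zero, sub_zero, inv_inv, smul_eq_mul]
    rw [← Real.arctan_inv_of_pos (by positivity), inv_div, div_eq_mul_inv]
  have h2 : Tendsto (fun N : ℕ => t / 2 * Real.log (t ^ 2 + (a + (N + 2 : ℕ)) ^ 2) -
      t * Real.log (N + 1)) atTop (𝓝 0) := by
    have hi : Tendsto (fun N : ℕ => (1 : ℝ) / (N + 1)) atTop (𝓝 0) :=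
      tendsto_one_div_add_atTop_nhds_zero_nat
    have hr : Tendsto (fun N : ℕ => (t * (1 / ((N : ℝ) + 1))) ^ 2 +
        ((a + 1) * (1 / ((N : ℝ) + 1)) + 1) ^ 2) atTop (𝓝 1) := by
      have := ((hi.const_mul t).pow 2).add (((hi.const_mul (a + 1)).add_const 1).pow 2)
      simpa using this
    have hl := ((Real.continuousAt_log one_ne_zero).tendsto.comp hr).const_mul (t / 2)
    rw [Real.log_one, mul_zero] at hl
    refine hl.congr fun N => ?_
    have hN : (0 : ℝ) < N + 1 := by positivity
    have e : (t * (1 / ((N : ℝ) + 1))) ^ 2 + ((a + 1) * (1 / ((N : ℝ) + 1)) + 1) ^ 2 =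
        (t ^ 2 + (a + (N + 2 : ℕ)) ^ 2) / (N + 1) ^ 2 := by
      push_cast
      field_simp
      ring
    simp only [Function.comp]
    rw [e, Real.log_div (by positivity) (by positivity), Real.log_pow]
    push_cast
    ring
  have := (h1.add h2).neg
  rw [add_zero] at this
  refine this.congr fun N => ?_
  ring

/-- **Stirling's formula** for the argument of the Gamma function on a vertical line. -/
theorem abs_im_logGamma_sub_le {a t : ℝ} (ha : 0 < a) (ht : 1 ≤ t) :
    |(logGamma (a + t * I)).im - (t * Real.log t - t)| ≤ a * (Real.pi / 2) + a ^ 2 + Real.pi / 2 := by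
  have ht0 : 0 < t := by linarith
  set β : ℝ → ℝ := fun x => Real.pi / 2 - Real.arctan (x / t) with hβ
  set Φ : ℝ → ℝ := fun x => x * β x + t / 2 * Real.log (t ^ 2 + x ^ 2) with hΦ
  have hanti : Antitone β := fun x y hxy => by
    have : Real.arctan (x / t) ≤ Real.arctan (y / t) := Real.arctan_mono (by gcongr)
    simp only [hβ]; linarith
  have hβcont : Continuous β := by
    simp only [hβ]; exact continuous_const.sub (Real.continuous_arctan.comp (by fun_prop))
  have hβ0 : ∀ x, 0 ≤ β x := fun x => by
    have := Real.arctan_lt_pi_div_two (x / t); simp only [hβ]; linarith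
  have hβa : β a ≤ Real.pi / 2 := by
    have : 0 ≤ Real.arctan (a / t) := Real.arctan_nonneg.2 (by positivity)
    simp only [hβ]; linarith
  have hint : ∀ x y, ∫ u in x..y, β u = Φ y - Φ x := fun x y =>
    intervalIntegral.integral_eq_sub_of_hasDerivAt
      (fun u _ => hasDerivAt_stirlingPrimitive ht0 u) (hβcont.intervalIntegrable _ _)
  have hterm : ∀ N : ℕ, ∑ j ∈ Finset.range (N + 2), Real.arctan (t / (a + j)) =
      ∑ j ∈ Finset.range (N + 2), β (a + j) := by
    intro N
    refine Finset.sum_congr rfl fun j _ => ?_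
    simp only [hβ]
    rw [← Real.arctan_inv_of_pos (by positivity), inv_div]
  -- As β decreases, the sum exceeds the integral by at most its first term, which is at most π/2.
  have hlow : ∀ N : ℕ, Φ (a + (N + 2 : ℕ)) - Φ a ≤ ∑ j ∈ Finset.range (N + 2), β (a + j) := by
    intro N
    rw [← hint]
    exact (hanti.antitoneOn _).integral_le_sum
  have hup : ∀ N : ℕ, ∑ j ∈ Finset.range (N + 2), β (a + j) ≤
      Φ (a + (N + 2 : ℕ)) - Φ a + Real.pi / 2 := by
    intro N
    have h1 := (hanti.antitoneOn (Icc a (a + (N + 2 : ℕ)))).sum_le_integral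
    rw [hint] at h1
    have h2 : ∑ j ∈ Finset.range (N + 2), β (a + j) ≤ ∑ j ∈ Finset.range (N + 3), β (a + j) := by
      rw [Finset.sum_range_succ _ (N + 2)]
      linarith [hβ0 (a + (N + 2 : ℕ))]
    rw [Finset.sum_range_succ' _ (N + 2)] at h2
    simp only [Nat.cast_zero, add_zero] at h2
    linarith
  have hlim := tendsto_im_logGamma ha t
  have hst : Tendsto (fun N : ℕ => t * Real.log (N + 1) - Φ (a + (N + 2 : ℕ))) atTop (𝓝 (-t)) :=
    tendsto_stirlingPrimitive ha ht0
  have u1 : (logGamma (a + t * I)).im ≤ -t + Φ a := by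
    refine le_of_tendsto_of_tendsto' hlim (hst.add_const (Φ a)) fun N => ?_
    have := hlow N
    rw [hterm N]
    linarith
  have u2 : -t + (Φ a - Real.pi / 2) ≤ (logGamma (a + t * I)).im := by
    refine le_of_tendsto_of_tendsto' (hst.add_const (Φ a - Real.pi / 2)) hlim fun N => ?_
    have := hup N
    rw [hterm N]
    linarith
  -- The main term t log t comes from the first summand; the second costs at most a² after
  -- multiplication by t ≥ 1.
  have hlog : Real.log (t ^ 2 + a ^ 2) = 2 * Real.log t + Real.log (1 + a ^ 2 / t ^ 2) := by
    rw [show t ^ 2 + a ^ 2 = t ^ 2 * (1 + a ^ 2 / t ^ 2) by field_simp,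
      Real.log_mul (by positivity) (by positivity), Real.log_pow]
    push_cast; ring
  have l0 : 0 ≤ Real.log (1 + a ^ 2 / t ^ 2) :=
    Real.log_nonneg (by linarith [div_nonneg (sq_nonneg a) (sq_nonneg t)])
  have l1 : t * Real.log (1 + a ^ 2 / t ^ 2) ≤ a ^ 2 := by
    have := Real.log_le_sub_one_of_pos (by positivity : 0 < 1 + a ^ 2 / t ^ 2)
    calc t * Real.log (1 + a ^ 2 / t ^ 2) ≤ t * (a ^ 2 / t ^ 2) := by gcongr; linarith
      _ = a ^ 2 / t := by field_simp
      _ ≤ a ^ 2 := div_le_self (by positivity) ht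
  have hΦa : Φ a = a * β a + (t * Real.log t + t * Real.log (1 + a ^ 2 / t ^ 2) / 2) := by
    simp only [hΦ]
    rw [hlog]; ring
  have m1 : 0 ≤ a * β a := mul_nonneg ha.le (hβ0 a)
  have m2 : a * β a ≤ a * (Real.pi / 2) := by gcongr
  have m3 : 0 ≤ t * Real.log (1 + a ^ 2 / t ^ 2) := by positivity
  rw [abs_le]
  constructor <;> nlinarith [Real.pi_pos, sq_nonneg a]

end LogGamma

/-! ### The entire function ξ, its zeros and its logarithmic derivative. -/

section CompletedZeta

open Complex

/-- The entire function `s (s - 1) Λ(s)`, whose zeros are the nontrivial zeros of `ζ`. -/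
noncomputable def riemannXi (s : ℂ) : ℂ := s * (s - 1) * completedRiemannZeta₀ s + 1

theorem differentiable_riemannXi : Differentiable ℂ riemannXi := by
  have := differentiable_completedZeta₀
  unfold riemannXi
  fun_prop

theorem riemannXi_one_sub (s : ℂ) : riemannXi (1 - s) = riemannXi s := by
  rw [riemannXi, riemannXi, completedRiemannZeta₀_one_sub]
  ring

theorem riemannXi_eq_mul_riemannZeta {s : ℂ} (hs : 0 < s.re) (h1 : s ≠ 1) :
    riemannXi s = s * (s - 1) * Gammaℝ s * riemannZeta s := by
  have h0 : s ≠ 0 := by rintro rfl; simp at hs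
  have hG := Gammaℝ_ne_zero_of_re_pos hs
  have h2 : 1 - s ≠ 0 := sub_ne_zero.2 h1.symm
  rw [riemannZeta_def_of_ne_zero h0, completedRiemannZeta_eq, riemannXi]
  field_simp
  ring

/-- A holomorphic logarithm of `s Γℝ(s)` on the right half plane. -/
noncomputable def logXiFactor (s : ℂ) : ℂ := log s + logGamma (s / 2) - s / 2 * Real.log Real.pi

theorem exp_logXiFactor {s : ℂ} (hs : 0 < s.re) : exp (logXiFactor s) = s * Gammaℝ s := by
  have h0 : s ≠ 0 := by rintro rfl; simp at hs
  rw [logXiFactor, sub_eq_add_neg, exp_add, exp_add, exp_log h0, exp_logGamma (by simpa), Gammaℝ_def,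
    cpow_def_of_ne_zero (by exact_mod_cast Real.pi_ne_zero), ofReal_log Real.pi_pos.le,
    show -(s / 2 * log (Real.pi : ℂ)) = log Real.pi * (-s / 2) by ring]
  ring

theorem riemannXi_eq_exp_mul {s : ℂ} (hs : 0 < s.re) :
    riemannXi s = exp (logXiFactor s) * riemannZeta₁ s := by
  rw [exp_logXiFactor hs]
  by_cases h1 : s = 1
  · subst h1
    simp [riemannXi]
  · rw [riemannXi_eq_mul_riemannZeta hs h1, riemannZeta_eq_inv_sub_mul h1]
    have := sub_ne_zero.2 h1
    field_simp

theorem differentiableAt_logXiFactor {s : ℂ} (hs : 0 < s.re) :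
    DifferentiableAt ℂ logXiFactor s := by
  have h1 : DifferentiableAt ℂ (fun s : ℂ => logGamma (s / 2)) s :=
    DifferentiableAt.comp (g := logGamma) (f := fun s : ℂ => s / 2) s
      (hasDerivAt_logGamma (by simpa)).differentiableAt (by fun_prop)
  have h2 : DifferentiableAt ℂ (fun s : ℂ => log s) s := differentiableAt_id.clog (Or.inl hs)
  have h3 : DifferentiableAt ℂ (fun s : ℂ => s / 2 * (Real.log Real.pi : ℂ)) s := by fun_prop
  exact (h2.add h1).sub h3

/-- For Re s > 0 the factor in front of ζ has no zero except s = 1, where ξ = 1, and ζ does not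
vanish on Re s ≥ 1. The functional equation covers Re s ≤ 0. -/
theorem riemannXi_eq_zero_iff {s : ℂ} : riemannXi s = 0 ↔ s ∈ nontrivialZetaZeros := by
  have key : ∀ s : ℂ, 0 < s.re → (riemannXi s = 0 ↔ s ∈ nontrivialZetaZeros) := by
    intro s hs
    by_cases h1 : s = 1
    · subst h1
      simp [riemannXi, nontrivialZetaZeros]
    · have h0 : s ≠ 0 := by rintro rfl; simp at hs
      rw [riemannXi_eq_mul_riemannZeta hs h1]
      simp only [mul_eq_zero, h0, sub_ne_zero.2 h1, Gammaℝ_ne_zero_of_re_pos hs, false_or]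
      refine ⟨fun h => ⟨h, hs, ?_⟩, fun h => h.1⟩
      by_contra hc
      exact riemannZeta_ne_zero_of_one_le_re (not_lt.1 hc) h
  rcases lt_or_ge 0 s.re with hs | hs
  · exact key s hs
  · have h1 : ¬ riemannXi s = 0 := by
      rw [← riemannXi_one_sub, key (1 - s) (by simp; linarith)]
      intro h
      have := h.2.2
      simp at this
      linarith
    exact ⟨fun h => (h1 h).elim, fun h => absurd h.2.1 (not_lt.2 hs)⟩

theorem one_sub_mem_nontrivialZetaZeros {ρ : ℂ} (h : ρ ∈ nontrivialZetaZeros) :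
    1 - ρ ∈ nontrivialZetaZeros := by
  rw [← riemannXi_eq_zero_iff] at h ⊢
  rwa [riemannXi_one_sub]

theorem riemannZeta₁_eq_zero_iff {s : ℂ} (hs : 0 < s.re) :
    riemannZeta₁ s = 0 ↔ s ∈ nontrivialZetaZeros := by
  rw [← riemannXi_eq_zero_iff, riemannXi_eq_exp_mul hs]
  simp

theorem analyticOrderAt_riemannXi {ρ : ℂ} (h : ρ ∈ nontrivialZetaZeros) :
    analyticOrderAt riemannXi ρ = analyticOrderAt riemannZeta ρ := by
  have hs : 0 < ρ.re := h.2.1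
  have h1 : ρ ≠ 1 := by rintro rfl; exact absurd h.2.2 (by simp)
  have h0 : ρ ≠ 0 := by rintro rfl; simp at hs
  have hU : {s : ℂ | 0 < s.re} ∩ {1}ᶜ ∈ 𝓝 ρ :=
    ((isOpen_lt continuous_const continuous_re).inter isOpen_compl_singleton).mem_nhds ⟨hs, h1⟩
  have he : riemannXi =ᶠ[𝓝 ρ] (fun s => (s - 1) * exp (logXiFactor s)) * riemannZeta := by
    filter_upwards [hU] with s hs'
    rw [riemannXi_eq_mul_riemannZeta hs'.1 hs'.2, Pi.mul_apply, exp_logXiFactor hs'.1]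
    ring
  have hA : AnalyticAt ℂ (fun s => (s - 1) * exp (logXiFactor s)) ρ := by
    refine DifferentiableOn.analyticAt (s := {s : ℂ | 0 < s.re} ∩ {1}ᶜ) (fun s hs' => ?_) hU
    have := differentiableAt_logXiFactor hs'.1
    exact DifferentiableAt.differentiableWithinAt (by fun_prop)
  rw [analyticOrderAt_congr he, analyticOrderAt_mul hA (analyticOn_riemannZeta ρ h1),
    hA.analyticOrderAt_eq_zero.2 (mul_ne_zero (sub_ne_zero.2 h1) (exp_ne_zero _)), zero_add]

theorem analyticOrderNatAt_riemannXi {ρ : ℂ} (h : ρ ∈ nontrivialZetaZeros) :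
    analyticOrderNatAt riemannXi ρ = zetaZeroMultiplicity ρ := by
  rw [zetaZeroMultiplicity, analyticOrderNatAt, analyticOrderNatAt, analyticOrderAt_riemannXi h]

/-- Multiplicities are read off from ξ, which is invariant under s ↦ 1 − s; this map has nonzero
derivative and preserves orders. -/
theorem zetaZeroMultiplicity_one_sub {ρ : ℂ} (h : ρ ∈ nontrivialZetaZeros) :
    zetaZeroMultiplicity (1 - ρ) = zetaZeroMultiplicity ρ := by
  rw [← analyticOrderNatAt_riemannXi h,
    ← analyticOrderNatAt_riemannXi (one_sub_mem_nontrivialZetaZeros h)]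
  have hd : HasDerivAt (fun s : ℂ => 1 - s) (-1) ρ := by
    simpa using (hasDerivAt_id ρ).const_sub 1
  have h1 := analyticOrderAt_comp_of_deriv_ne_zero (f := riemannXi) (g := fun s : ℂ => 1 - s)
    (z₀ := ρ) (by fun_prop) (by rw [hd.deriv]; norm_num)
  rw [analyticOrderNatAt, analyticOrderNatAt, ← h1]
  congr 2
  ext s
  exact riemannXi_one_sub s

theorem analyticOrderAt_riemannXi_ne_top (s : ℂ) : analyticOrderAt riemannXi s ≠ ⊤ :=
  analyticOrderAt_ne_top_of_differentiable differentiable_riemannXi (c := 0) (by simp [riemannXi]) s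

theorem logDeriv_riemannXi_one_sub (s : ℂ) :
    logDeriv riemannXi (1 - s) = -logDeriv riemannXi s := by
  have h : deriv riemannXi (1 - s) = -deriv riemannXi s := by
    have h1 : deriv (fun w => riemannXi (1 - w)) s = -deriv riemannXi (1 - s) :=
      deriv_comp_const_sub riemannXi 1 s
    rw [show (fun w => riemannXi (1 - w)) = riemannXi from funext riemannXi_one_sub] at h1
    rw [h1, neg_neg]
  rw [logDeriv_apply, logDeriv_apply, h, riemannXi_one_sub, neg_div]

theorem logDeriv_riemannXi {s : ℂ} (hs : 0 < s.re) (h : s ∉ nontrivialZetaZeros) :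
    logDeriv riemannXi s = deriv logXiFactor s + logDeriv riemannZeta₁ s := by
  have hd := differentiableAt_logXiFactor hs
  have he : riemannXi =ᶠ[𝓝 s] fun w => exp (logXiFactor w) * riemannZeta₁ w := by
    filter_upwards [(isOpen_lt continuous_const continuous_re).mem_nhds hs] with w hw
    exact riemannXi_eq_exp_mul hw
  rw [(logDeriv_congr_nhds he).eq_of_nhds, logDeriv_mul (f := fun w => exp (logXiFactor w)) s (exp_ne_zero _)
    (fun h' => h ((riemannZeta₁_eq_zero_iff hs).1 h')) hd.cexp (differentiable_riemannZeta₁ s)]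
  congr 1
  rw [logDeriv_apply, hd.hasDerivAt.cexp.deriv]
  field_simp

end CompletedZeta

/-! ### Additivity and symmetry of the zero count. -/

section ZeroCount

theorem zetaZeroCount_eq_sum {I : Set ℝ} (h : (zetaZerosWithOrdinateIn I).Finite) :
    zetaZeroCount I = ∑ ρ ∈ h.toFinset, zetaZeroMultiplicity ρ := by
  rw [zetaZeroCount, finsum_mem_eq_finite_toFinset_sum _ h]

theorem zetaZeroCount_mono {I J : Set ℝ} (hIJ : I ⊆ J) {a b : ℝ} (hJ : J ⊆ Icc a b) :
    zetaZeroCount I ≤ zetaZeroCount J := by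
  rw [zetaZeroCount_eq_sum (zetaZerosWithOrdinateIn_finite (hIJ.trans hJ)),
    zetaZeroCount_eq_sum (zetaZerosWithOrdinateIn_finite hJ)]
  refine Finset.sum_le_sum_of_subset fun ρ hρ => ?_
  rw [Set.Finite.mem_toFinset] at hρ ⊢
  exact ⟨hρ.1, hIJ hρ.2⟩

theorem zetaZeroCount_union {I J : Set ℝ} (hd : Disjoint I J) {a b : ℝ} (hI : I ⊆ Icc a b)
    (hJ : J ⊆ Icc a b) : zetaZeroCount (I ∪ J) = zetaZeroCount I + zetaZeroCount J := by
  have e : zetaZerosWithOrdinateIn (I ∪ J) =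
      zetaZerosWithOrdinateIn I ∪ zetaZerosWithOrdinateIn J := by
    ext; simp [zetaZerosWithOrdinateIn, and_or_left]
  rw [zetaZeroCount, zetaZeroCount, zetaZeroCount, e, finsum_mem_union ?_
    (zetaZerosWithOrdinateIn_finite hI) (zetaZerosWithOrdinateIn_finite hJ)]
  rw [Set.disjoint_left] at hd ⊢
  exact fun ρ h1 h2 => hd h1.2 h2.2

/-- The reflection ρ ↦ 1 − ρ negates the ordinate, so the functional equation suffices and complex
conjugation is not needed. -/
theorem zetaZeroCount_Ioo_neg (T : ℝ) : zetaZeroCount (Ioo (-T) 0) = zetaZeroCount (Ioo 0 T) := by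
  refine finsum_mem_eq_of_bijOn (fun ρ => 1 - ρ) ⟨?_, ?_, ?_⟩ ?_
  · rintro ρ ⟨h1, h2, h3⟩
    refine ⟨one_sub_mem_nontrivialZetaZeros h1, ?_, ?_⟩ <;> simp <;> linarith
  · exact fun a _ b _ h => sub_right_injective h
  · rintro ρ ⟨h1, h2, h3⟩
    refine ⟨1 - ρ, ⟨one_sub_mem_nontrivialZetaZeros h1, ?_, ?_⟩, by simp⟩ <;> simp <;> linarith
  · exact fun ρ h => (zetaZeroMultiplicity_one_sub h.1).symm

/-- Real zeros in the critical strip need not be excluded: their number is a constant, later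
absorbed in the error term. -/
theorem zetaZeroCount_Ioo_neg_self {T : ℝ} (hT : 0 < T) :
    zetaZeroCount (Ioo (-T) T) = 2 * zetaZeroCount (Ioo 0 T) + zetaZeroCount {0} := by
  have e : Ioo (-T) T = (Ioo (-T) 0 ∪ {0}) ∪ Ioo 0 T := by
    ext x
    simp only [mem_Ioo, mem_union, mem_singleton_iff]
    constructor
    · rintro ⟨h1, h2⟩
      rcases lt_trichotomy x 0 with h | h | h
      · exact Or.inl (Or.inl ⟨h1, h⟩)
      · exact Or.inl (Or.inr h)
      · exact Or.inr ⟨h, h2⟩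
    · rintro ((⟨h1, h2⟩ | h) | ⟨h1, h2⟩)
      · exact ⟨h1, by linarith⟩
      · subst h; exact ⟨by linarith, hT⟩
      · exact ⟨by linarith, h2⟩
  have s1 : Ioo (-T) 0 ⊆ Icc (-T) T := fun x hx => ⟨hx.1.le, by linarith [hx.2]⟩
  have s2 : ({0} : Set ℝ) ⊆ Icc (-T) T := by
    rintro x rfl; exact ⟨by linarith, hT.le⟩
  have s3 : Ioo 0 T ⊆ Icc (-T) T := fun x hx => ⟨by linarith [hx.1], hx.2.le⟩
  rw [e, zetaZeroCount_union ?_ (union_subset s1 s2) s3, zetaZeroCount_union ?_ s1 s2,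
    zetaZeroCount_Ioo_neg]
  · ring
  · simp
  · rw [Set.disjoint_left]
    rintro x (h | h) h'
    · linarith [h.2, h'.1]
    · rw [mem_singleton_iff] at h; linarith [h'.1]

end ZeroCount

/-! ### The Riemann–von Mangoldt formula. -/

section RiemannVonMangoldt

open Complex

/-- The explicit factor of ξ has the global logarithm `logXiFactor`, so its part of the integral
depends only on the endpoints. The velocity v is 1 on horizontal sides and i on the vertical one. -/
theorem intervalIntegral_logDeriv_xi_add {p : ℝ → ℂ} {v : ℂ}
    (hp : ∀ x, HasDerivAt p v x) {a b : ℝ}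
    (h : ∀ x ∈ uIcc a b, 0 < (p x).re ∧ p x ∉ nontrivialZetaZeros) :
    v * ∫ x in a..b, logDeriv riemannXi (p x) =
      logXiFactor (p b) - logXiFactor (p a) + v * ∫ x in a..b, logDeriv riemannZeta₁ (p x) := by
  have hpc : Continuous p := continuous_iff_continuousAt.2 fun x => (hp x).continuousAt
  have i1 : ContinuousOn (fun x => logDeriv riemannZeta₁ (p x)) (uIcc a b) := by
    intro x hx
    refine ContinuousAt.continuousWithinAt ?_
    refine ContinuousAt.comp (g := logDeriv riemannZeta₁) ?_ hpc.continuousAt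
    exact ((differentiable_riemannZeta₁.deriv _).div (differentiable_riemannZeta₁ _)
      fun h' => (h x hx).2 ((riemannZeta₁_eq_zero_iff (h x hx).1).1 h')).continuousAt
  have i2 : ContinuousOn (fun x => deriv logXiFactor (p x)) (uIcc a b) := by
    intro x hx
    refine ContinuousAt.continuousWithinAt ?_
    refine ContinuousAt.comp (g := deriv logXiFactor) ?_ hpc.continuousAt
    have hO : IsOpen {s : ℂ | 0 < s.re} := isOpen_lt continuous_const continuous_re
    have hd : DifferentiableOn ℂ logXiFactor {s : ℂ | 0 < s.re} := fun s hs =>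
      (differentiableAt_logXiFactor hs).differentiableWithinAt
    exact ((hd.deriv hO).differentiableAt (hO.mem_nhds (h x hx).1)).continuousAt
  have hftc : ∫ x in a..b, deriv logXiFactor (p x) * v = logXiFactor (p b) - logXiFactor (p a) := by
    refine intervalIntegral.integral_eq_sub_of_hasDerivAt (f := fun x => logXiFactor (p x))
      (fun x hx => ?_) (i2.mul_const v).intervalIntegrable
    exact (differentiableAt_logXiFactor (h x hx).1).hasDerivAt.comp x (hp x)
  rw [intervalIntegral.integral_congr (g := fun x =>
    deriv logXiFactor (p x) + logDeriv riemannZeta₁ (p x))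
    (fun x hx => logDeriv_riemannXi (h x hx).1 (h x hx).2),
    intervalIntegral.integral_add i2.intervalIntegrable i1.intervalIntegrable, mul_add, ← hftc,
    intervalIntegral.integral_mul_const, mul_comm v]

theorem notMem_nontrivialZetaZeros_of_one_le_re {s : ℂ} (h : 1 ≤ s.re) :
    s ∉ nontrivialZetaZeros := fun h' => absurd h'.2.2 (not_lt.2 h)

/-- Since ξ'/ξ is odd about 1/2, the half of the boundary left of Re s = 1/2 contributes as much as
the right half. -/
theorem rectIntegral_logDeriv_riemannXi {T : ℝ}
    (hz : ∀ ρ ∈ nontrivialZetaZeros, ρ.im ≠ T ∧ ρ.im ≠ -T) :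
    rectIntegral (logDeriv riemannXi) (-1) 2 (-T) T =
      2 * ((∫ x in (1 / 2 : ℝ)..2, logDeriv riemannXi (x + (-T : ℝ) * I)) -
        (∫ x in (1 / 2 : ℝ)..2, logDeriv riemannXi (x + T * I)) +
        I * ∫ y in (-T)..T, logDeriv riemannXi ((2 : ℝ) + y * I)) := by
  set h := logDeriv riemannXi with hh
  have hi : ∀ t : ℝ, (∀ ρ ∈ nontrivialZetaZeros, ρ.im ≠ t) → ∀ a b : ℝ,
      IntervalIntegrable (fun x : ℝ => h (x + t * I)) volume a b := by
    intro t ht a b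
    refine Continuous.intervalIntegrable ?_ _ _
    rw [continuous_iff_continuousAt]
    intro x
    refine ContinuousAt.comp (g := h) ?_ (f := fun x : ℝ => (x : ℂ) + t * I) (by fun_prop)
    refine ((differentiable_riemannXi.deriv _).div (differentiable_riemannXi _)
      fun h' => ?_).continuousAt
    exact ht _ (riemannXi_eq_zero_iff.1 h') (by simp)
  have hrefl : ∀ t : ℝ, ∫ x in (-1 : ℝ)..(1 / 2), h (x + t * I) =
      -∫ x in (1 / 2 : ℝ)..2, h (x + (-t : ℝ) * I) := by
    intro t
    have h1 := intervalIntegral.integral_comp_sub_left (a := 1 / 2) (b := 2)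
      (fun x : ℝ => h (x + t * I)) 1
    norm_num at h1
    rw [← h1, ← intervalIntegral.integral_neg]
    refine intervalIntegral.integral_congr fun x _ => ?_
    simp only [hh]
    rw [← logDeriv_riemannXi_one_sub]
    congr 1
    push_cast
    ring
  have hsplit : ∀ t : ℝ, (∀ ρ ∈ nontrivialZetaZeros, ρ.im ≠ t) →
      ∫ x in (-1 : ℝ)..2, h (x + t * I) = (∫ x in (1 / 2 : ℝ)..2, h (x + t * I)) -
        ∫ x in (1 / 2 : ℝ)..2, h (x + (-t : ℝ) * I) := by
    intro t ht
    rw [← intervalIntegral.integral_add_adjacent_intervals (hi t ht (-1) (1 / 2)) (hi t ht (1 / 2) 2),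
      hrefl]
    ring
  have hvert : ∫ y in (-T)..T, h ((-1 : ℝ) + y * I) = -∫ y in (-T)..T, h ((2 : ℝ) + y * I) := by
    have h1 := intervalIntegral.integral_comp_neg (a := -T) (b := T)
      (fun y : ℝ => h ((-1 : ℝ) + y * I))
    rw [neg_neg] at h1
    rw [← h1, ← intervalIntegral.integral_neg]
    refine intervalIntegral.integral_congr fun x _ => ?_
    simp only [hh]
    rw [← logDeriv_riemannXi_one_sub]
    congr 1
    push_cast
    ring
  rw [rectIntegral, hsplit T fun ρ hρ => (hz ρ hρ).1, hsplit (-T) fun ρ hρ => (hz ρ hρ).2, hvert,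
    neg_neg]
  ring

/-- The number of zeros as the variation of the argument along half of the boundary. -/
theorem pi_mul_zetaZeroCount {T : ℝ} (hT : 0 < T)
    (hz : ∀ ρ ∈ nontrivialZetaZeros, ρ.im ≠ T ∧ ρ.im ≠ -T) :
    Real.pi * (zetaZeroCount (Ioo (-T) T) : ℝ) =
      (logXiFactor ((1 / 2 : ℝ) + T * I)).im - (logXiFactor ((1 / 2 : ℝ) + (-T : ℝ) * I)).im +
      (∫ x in (1 / 2 : ℝ)..2, logDeriv riemannZeta₁ (x + (-T : ℝ) * I)).im -
      (∫ x in (1 / 2 : ℝ)..2, logDeriv riemannZeta₁ (x + T * I)).im +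
      (I * ∫ y in (-T)..T, logDeriv riemannZeta₁ ((2 : ℝ) + y * I)).im := by
  have hfin : (zetaZerosWithOrdinateIn (Ioo (-T) T)).Finite :=
    zetaZerosWithOrdinateIn_finite Ioo_subset_Icc_self
  have h1 := rectIntegral_logDeriv differentiable_riemannXi analyticOrderAt_riemannXi_ne_top
    (a := -1) (b := 2) (c := -T) (d := T) (by norm_num) (by linarith) hfin.toFinset
    (by
      intro ρ hρ
      rw [Set.Finite.mem_toFinset] at hρ
      exact ⟨by linarith [hρ.1.2.1], by linarith [hρ.1.2.2], hρ.2.1, hρ.2.2⟩)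
    (by
      intro z hz1 hz0
      rw [riemannXi_eq_zero_iff] at hz0
      rw [Set.Finite.mem_toFinset]
      obtain ⟨-, h3, h4⟩ := hz1
      exact ⟨hz0, lt_of_le_of_ne h3 (hz z hz0).2.symm, lt_of_le_of_ne h4 (hz z hz0).1⟩)
  have hsum : ∑ ρ ∈ hfin.toFinset, (analyticOrderNatAt riemannXi ρ : ℂ) =
      ((zetaZeroCount (Ioo (-T) T) : ℝ) : ℂ) := by
    rw [zetaZeroCount_eq_sum hfin]
    push_cast
    refine Finset.sum_congr rfl fun ρ hρ => ?_
    rw [Set.Finite.mem_toFinset] at hρ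
    rw [analyticOrderNatAt_riemannXi hρ.1]
  rw [hsum, rectIntegral_logDeriv_riemannXi hz] at h1
  have hH : ∀ t : ℝ, (∀ ρ ∈ nontrivialZetaZeros, ρ.im ≠ t) →
      ∫ x in (1 / 2 : ℝ)..2, logDeriv riemannXi (x + t * I) =
        logXiFactor ((2 : ℝ) + t * I) - logXiFactor ((1 / 2 : ℝ) + t * I) +
          ∫ x in (1 / 2 : ℝ)..2, logDeriv riemannZeta₁ (x + t * I) := by
    intro t ht
    have := intervalIntegral_logDeriv_xi_add (p := fun x : ℝ => (x : ℂ) + t * I) (v := 1)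
      (fun x => by simpa using (ofRealCLM.hasDerivAt (x := x)).add_const (t * I : ℂ)) (a := 1 / 2) (b := 2) (by
        intro x hx
        rw [uIcc_of_le (by norm_num)] at hx
        refine ⟨by simp; linarith [hx.1], fun h' => ht _ h' (by simp)⟩)
    simpa only [one_mul] using this
  have hV := intervalIntegral_logDeriv_xi_add (p := fun y : ℝ => ((2 : ℝ) : ℂ) + y * I)
      (fun y => by simpa using (ofRealCLM.hasDerivAt.mul_const I).const_add ((2 : ℝ) : ℂ))
      (a := -T) (b := T) (by
        intro x _
        exact ⟨by simp, notMem_nontrivialZetaZeros_of_one_le_re (by simp)⟩)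
  rw [hH T fun ρ hρ => (hz ρ hρ).1, hH (-T) fun ρ hρ => (hz ρ hρ).2, hV] at h1
  -- The values of `logXiFactor` at 2 ± iT cancel between adjacent sides; only those at 1/2 ± iT
  -- survive.
  have h2 := congrArg Complex.im h1
  have e : (2 * (Real.pi : ℂ) * I * ((zetaZeroCount (Ioo (-T) T) : ℝ) : ℂ)).im =
      2 * (Real.pi * (zetaZeroCount (Ioo (-T) T) : ℝ)) := by
    rw [show 2 * (Real.pi : ℂ) * I * ((zetaZeroCount (Ioo (-T) T) : ℝ) : ℂ) =
      ((2 * (Real.pi * (zetaZeroCount (Ioo (-T) T) : ℝ)) : ℝ) : ℂ) * I by push_cast; ring]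
    rw [im_ofReal_mul, I_im, mul_one]
  rw [e] at h2
  rw [show ∀ z : ℂ, 2 * z = ((2 : ℝ) : ℂ) * z from fun z => by norm_num, im_ofReal_mul] at h2
  simp only [add_im, sub_im] at h2
  linarith

theorem riemannZeta₁_eq {s : ℂ} (hs : s ≠ 1) : riemannZeta₁ s = (s - 1) * riemannZeta s := by
  rw [riemannZeta_eq_inv_sub_mul hs, mul_inv_cancel_left₀ (sub_ne_zero.2 hs)]

/-- On Re s = 2 both s − 1 and ζ(s) have positive real part, so the sum of their principal
logarithms is a logarithm of (s − 1)ζ(s). The bound is four arguments of size at most π. -/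
theorem abs_im_vertical_integral_le (T : ℝ) :
    |(I * ∫ y in (-T)..T, logDeriv riemannZeta₁ ((2 : ℝ) + y * I)).im| ≤ 4 * Real.pi := by
  set p : ℝ → ℂ := fun y => ((2 : ℝ) : ℂ) + y * I with hp
  have hp2 : ∀ y, (p y).re = 2 := fun y => by simp [hp]
  have hp1 : ∀ y, p y ≠ 1 := fun y h => by have := congrArg re h; rw [hp2] at this; norm_num at this
  have hpd : ∀ y, HasDerivAt p I y := fun y => by
    simpa [hp] using (ofRealCLM.hasDerivAt.mul_const I).const_add ((2 : ℝ) : ℂ)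
  have hne : ∀ y, riemannZeta₁ (p y) ≠ 0 := fun y h' =>
    notMem_nontrivialZetaZeros_of_one_le_re (by rw [hp2]; norm_num)
      ((riemannZeta₁_eq_zero_iff (by rw [hp2]; norm_num)).1 h')
  have hd : ∀ y, HasDerivAt (fun y => log (p y - 1) + log (riemannZeta (p y)))
      (I * logDeriv riemannZeta₁ (p y)) y := by
    intro y
    have s1 : p y - 1 ∈ slitPlane := Or.inl (by rw [sub_re, hp2]; norm_num)
    have s2 : riemannZeta (p y) ∈ slitPlane := Or.inl (re_riemannZeta_pos (hp2 y))
    have hz := (differentiableAt_riemannZeta (hp1 y)).hasDerivAt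
    have d1 := ((hpd y).sub_const 1).clog_real s1
    have d2 := (hz.comp y (hpd y)).clog_real s2
    convert! d1.add d2 using 1
    have he : riemannZeta₁ =ᶠ[𝓝 (p y)] fun s => (s - 1) * riemannZeta s := by
      filter_upwards [isOpen_ne.mem_nhds (hp1 y)] with s hs using riemannZeta₁_eq hs
    rw [(logDeriv_congr_nhds he).eq_of_nhds, logDeriv_mul (f := fun s => s - 1) _ (slitPlane_ne_zero s1) (slitPlane_ne_zero s2)
      (by fun_prop) hz.differentiableAt, logDeriv_apply, logDeriv_apply]
    simp
    ring
  have hc : Continuous fun y => I * logDeriv riemannZeta₁ (p y) := by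
    refine continuous_const.mul (continuous_iff_continuousAt.2 fun y => ?_)
    refine ContinuousAt.comp (g := logDeriv riemannZeta₁) ?_ (hpd y).continuousAt
    exact ((differentiable_riemannZeta₁.deriv _).div (differentiable_riemannZeta₁ _)
      (hne y)).continuousAt
  rw [← intervalIntegral.integral_const_mul,
    intervalIntegral.integral_eq_sub_of_hasDerivAt (fun y _ => hd y) (hc.intervalIntegrable _ _)]
  simp only [sub_im, add_im, log_im]
  have a1 := abs_le.1 (abs_arg_le_pi (p T - 1))
  have a2 := abs_le.1 (abs_arg_le_pi (riemannZeta (p T)))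
  have a3 := abs_le.1 (abs_arg_le_pi (p (-T) - 1))
  have a4 := abs_le.1 (abs_arg_le_pi (riemannZeta (p (-T))))
  rw [abs_le]
  constructor <;> linarith [a1.1, a1.2]

/-- The general bound is used with centre 2 + it: there the function is at least 7/20 in modulus,
and on the large disc it grows at most like (5 + |t|)², so log M = O(1 + log |t|). -/
theorem abs_im_horizontal_integral_le : ∃ K : ℝ, 0 < K ∧ ∀ t : ℝ, 1 ≤ |t| →
    (∀ ρ ∈ nontrivialZetaZeros, ρ.im ≠ t) →
    |(∫ x in (1 / 2 : ℝ)..2, logDeriv riemannZeta₁ (x + t * I)).im| ≤ K * (1 + Real.log |t|) := by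
  obtain ⟨K, hK, h⟩ := abs_im_integral_logDeriv_le
  obtain ⟨C, hC, hg⟩ := norm_riemannZeta₁_le (σ := 1 / 10) (by norm_num)
  set B := Real.log (1 + 3 * C) + 2 * Real.log 6
  have hB : 0 ≤ B := by
    have := Real.log_nonneg (by linarith : (1 : ℝ) ≤ 1 + 3 * C)
    have := Real.log_nonneg (by norm_num : (1 : ℝ) ≤ 6)
    positivity
  refine ⟨K * (3 + B), by positivity, fun t ht hz => ?_⟩
  set c : ℂ := (2 : ℝ) + t * I with hc
  have hcre : c.re = 2 := by simp [hc]
  have hcim : c.im = t := by simp [hc]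
  have hc1 : c ≠ 1 := fun h => by have := congrArg re h; rw [hcre] at this; norm_num at this
  have hcn : ‖c‖ ≤ 2 + |t| := by
    have := norm_le_abs_re_add_abs_im c
    rwa [hcre, hcim, abs_of_pos two_pos] at this
  have hfc : 7 / 20 ≤ ‖riemannZeta₁ c‖ := by
    rw [riemannZeta₁_eq hc1, norm_mul]
    have h1 : 1 ≤ ‖c - 1‖ := le_trans (by rw [sub_re, hcre]; norm_num) (re_le_norm _)
    have h2 := norm_riemannZeta_ge hcre
    nlinarith
  -- The 3C compensates the lower bound 7/20 at the centre, as 3 · 7/20 > 1; the summand 1 ensures M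
  -- ≥ 1.
  set M := (1 + 3 * C) * (5 + |t|) ^ 2
  have hM1 : 1 ≤ M := by
    have : 1 ≤ (5 + |t|) ^ 2 := by nlinarith
    nlinarith
  have hball : ∀ r : ℝ, ∀ z ∈ Metric.closedBall c r, 2 - r ≤ z.re := by
    intro r z hz'
    rw [Metric.mem_closedBall, dist_eq_norm] at hz'
    have h1 := (abs_le.1 ((abs_re_le_norm (z - c)).trans hz')).1
    rw [sub_re, hcre] at h1
    linarith
  have key := h riemannZeta₁ c M differentiable_riemannZeta₁
    (fun h0 => by rw [h0, norm_zero] at hfc; norm_num at hfc) hM1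
    (by
      intro z hz'
      have h1 := hg z (by linarith [hball _ z hz'])
      rw [Metric.mem_closedBall, dist_eq_norm] at hz'
      have h2 : ‖z‖ ≤ 4 + |t| := by
        have := norm_le_norm_sub_add z c
        linarith
      have h3 : 1 + ‖z‖ ≤ 5 + |t| := by linarith
      calc ‖riemannZeta₁ z‖ ≤ C * (1 + ‖z‖) ^ 2 := h1
        _ ≤ C * (5 + |t|) ^ 2 := by gcongr
        _ ≤ M * (7 / 20) := by
            have : 0 ≤ (5 + |t|) ^ 2 := by positivity
            simp only [M]
            nlinarith [mul_nonneg hC.le this]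
        _ ≤ M * ‖riemannZeta₁ c‖ := by gcongr)
    (by
      intro z hz' h0
      rw [hcim]
      exact hz z ((riemannZeta₁_eq_zero_iff (by linarith [hball _ z hz'])).1 h0))
  have hint : ∫ x in (-(3 / 2) : ℝ)..0, logDeriv riemannZeta₁ (c + x) =
      ∫ x in (1 / 2 : ℝ)..2, logDeriv riemannZeta₁ (x + t * I) := by
    have := intervalIntegral.integral_comp_add_left (a := -(3 / 2)) (b := 0)
      (fun x : ℝ => logDeriv riemannZeta₁ (x + t * I)) 2
    norm_num at this
    rw [← this]
    refine intervalIntegral.integral_congr fun x _ => ?_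
    simp only [hc]
    congr 1
    push_cast
    ring
  rw [hint] at key
  have hlog : Real.log M ≤ B + 2 * Real.log |t| := by
    have h1 : 5 + |t| ≤ 6 * |t| := by linarith
    have h2 : Real.log (5 + |t|) ≤ Real.log 6 + Real.log |t| := by
      rw [← Real.log_mul (by norm_num) (by positivity)]
      exact Real.log_le_log (by positivity) h1
    simp only [M, B]
    rw [Real.log_mul (by positivity) (by positivity), Real.log_pow]
    push_cast
    linarith
  have hlt : 0 ≤ Real.log |t| := Real.log_nonneg ht
  refine key.trans ?_
  rw [mul_assoc]
  gcongr
  nlinarith [mul_nonneg hB hlt]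

/-- Stirling at 1/4 ± iT/2 gives twice (T/2) log(T/2) − T/2, and the power of π contributes −T log
π; together they form the main term. -/
theorem abs_im_logXiFactor_sub_le {T : ℝ} (hT : 2 ≤ T) :
    |(logXiFactor ((1 / 2 : ℝ) + T * I)).im - (logXiFactor ((1 / 2 : ℝ) + (-T : ℝ) * I)).im -
      T * (Real.log (T / (2 * Real.pi)) - 1)| ≤ 20 := by
  have hpi := Real.pi_pos
  have h1 := abs_le.1 (abs_im_logGamma_sub_le (a := 1 / 4) (t := T / 2) (by norm_num) (by linarith))
  have h2 := im_logGamma_neg (a := 1 / 4) (by norm_num) (T / 2)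
  have e1 : (((1 / 2 : ℝ) : ℂ) + T * I) / 2 = ((1 / 4 : ℝ) : ℂ) + ((T / 2 : ℝ) : ℂ) * I := by
    push_cast; ring
  have e2 : (((1 / 2 : ℝ) : ℂ) + (-T : ℝ) * I) / 2 = ((1 / 4 : ℝ) : ℂ) - ((T / 2 : ℝ) : ℂ) * I := by
    push_cast; ring
  have e3 : Real.log (T / (2 * Real.pi)) = Real.log (T / 2) - Real.log Real.pi := by
    rw [← div_div, Real.log_div (by positivity) (by positivity)]
  have a1 := abs_le.1 (abs_arg_le_pi (((1 / 2 : ℝ) : ℂ) + T * I))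
  have a2 := abs_le.1 (abs_arg_le_pi (((1 / 2 : ℝ) : ℂ) + (-T : ℝ) * I))
  simp only [logXiFactor, sub_im, add_im, log_im, im_mul_ofReal]
  rw [e1, e2, h2, e3]
  have i1 : (((1 / 4 : ℝ) : ℂ) + ((T / 2 : ℝ) : ℂ) * I).im = T / 2 := by simp
  have i2 : (((1 / 4 : ℝ) : ℂ) - ((T / 2 : ℝ) : ℂ) * I).im = -(T / 2) := by simp
  rw [i1, i2]
  have := Real.pi_lt_d2
  rw [abs_le]
  constructor <;> linarith [h1.1, h1.2, a1.1, a1.2, a2.1, a2.2]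

theorem abs_zetaZeroCount_sub_le : ∃ K : ℝ, 0 < K ∧ ∀ T : ℝ, 2 ≤ T →
    (∀ ρ ∈ nontrivialZetaZeros, ρ.im ≠ T ∧ ρ.im ≠ -T) →
    |(zetaZeroCount (Ioo 0 T) : ℝ) - T / (2 * Real.pi) * (Real.log (T / (2 * Real.pi)) - 1)| ≤
      K * (1 + Real.log T) := by
  obtain ⟨K, hK, hH⟩ := abs_im_horizontal_integral_le
  have hpi := Real.pi_pos
  refine ⟨K + 20 + (zetaZeroCount {0} : ℝ), by positivity, fun T hT hz => ?_⟩
  have hT0 : 0 < T := by linarith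
  have h1 := pi_mul_zetaZeroCount hT0 hz
  have h2 := abs_le.1 (abs_im_logXiFactor_sub_le hT)
  have h3 := abs_le.1 (hH T (by rw [abs_of_pos hT0]; linarith) fun ρ hρ => (hz ρ hρ).1)
  have h4 := abs_le.1 (hH (-T) (by rw [abs_neg, abs_of_pos hT0]; linarith) fun ρ hρ => (hz ρ hρ).2)
  have h5 := abs_le.1 (abs_im_vertical_integral_le T)
  rw [abs_of_pos hT0] at h3
  rw [abs_neg, abs_of_pos hT0] at h4
  rw [zetaZeroCount_Ioo_neg_self hT0] at h1
  rw [Nat.cast_add, Nat.cast_mul, Nat.cast_ofNat] at h1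
  have hl : 0 ≤ Real.log T := Real.log_nonneg (by linarith)
  set n : ℝ := (zetaZeroCount (Ioo 0 T) : ℝ)
  set n0 : ℝ := (zetaZeroCount {0} : ℝ) with hn0
  have hn0' : 0 ≤ n0 := Nat.cast_nonneg _
  set m := T * (Real.log (T / (2 * Real.pi)) - 1) with hm
  have hpi3 := Real.pi_gt_three
  have hpi4 := Real.pi_lt_d2
  have e : n - T / (2 * Real.pi) * (Real.log (T / (2 * Real.pi)) - 1) =
      (2 * Real.pi * n - m) / (2 * Real.pi) := by
    rw [hm]; field_simp
  -- 34 covers 20 from the explicit factor and 4π from the vertical side.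
  have hbd : |2 * Real.pi * n - m| ≤ 2 * K * (1 + Real.log T) + 34 + Real.pi * n0 := by
    rw [abs_le]
    constructor <;> nlinarith [h2.1, h2.2, h3.1, h3.2, h4.1, h4.2, h5.1, h5.2]
  rw [e, abs_div, abs_of_pos (by positivity : 0 < 2 * Real.pi), div_le_iff₀ (by positivity)]
  refine hbd.trans ?_
  have k1 : 0 ≤ K * (1 + Real.log T) := by positivity
  have k2 : n0 ≤ n0 * (1 + Real.log T) := le_mul_of_one_le_right hn0' (by linarith)
  have k3 : (20 : ℝ) ≤ 20 * (1 + Real.log T) := by linarith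
  calc 2 * K * (1 + Real.log T) + 34 + Real.pi * n0
      ≤ (K * (1 + Real.log T) + 20 + n0) * (2 * Real.pi) := by nlinarith
    _ ≤ (K * (1 + Real.log T) + 20 * (1 + Real.log T) + n0 * (1 + Real.log T)) * (2 * Real.pi) := by
        gcongr
    _ = _ := by ring

/-- The function x(log x − 1) is convex with derivative log x. This controls the change of the main
term when T moves by less than 1. -/
theorem mul_log_sub_one_sub_le {a b : ℝ} (ha : 0 < a) (hb : 0 < b) :
    b * (Real.log b - 1) - a * (Real.log a - 1) ≤ (b - a) * Real.log b := by
  have h1 := Real.log_le_sub_one_of_pos (div_pos hb ha)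
  rw [Real.log_div hb.ne' ha.ne'] at h1
  have h2 : a * (Real.log b - Real.log a) ≤ a * (b / a - 1) := by gcongr
  have h3 : a * (b / a - 1) = b - a := by field_simp
  linarith

/-- The **Riemann–von Mangoldt formula**. -/
theorem abs_zetaQ_le : ∃ K : ℝ, 0 < K ∧ ∀ T : ℝ, 2 * Real.pi ≤ T → |zetaQ T| ≤ K * Real.log T := by
  obtain ⟨K, hK, h⟩ := abs_zetaZeroCount_sub_le
  have hpi := Real.pi_gt_three
  refine ⟨3 * K + 3, by positivity, fun T hT => ?_⟩
  have hT6 : 6 < T := by linarith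
  have hlogT : 1 ≤ Real.log T := by
    rw [Real.le_log_iff_exp_le (by linarith)]
    linarith [Real.exp_one_lt_d9]
  set B : Set ℝ := Complex.im '' zetaZerosWithOrdinateIn (Icc (-(T + 1)) (T + 1)) with hB
  have hBfin : B.Finite := (zetaZerosWithOrdinateIn_finite (Subset.refl _)).image _
  have hBneg : (Neg.neg '' B).Finite := hBfin.image _
  -- The count is known only at heights t such that neither t nor −t is an ordinate. Such heights u
  -- < T < t within distance 1 exist by finiteness, and monotonicity of the count transfers the
  -- bound to T.
  have pick : ∀ a b : ℝ, a < b → 0 < a → b ≤ T + 1 → ∃ t ∈ Ioo a b,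
      ∀ ρ ∈ nontrivialZetaZeros, ρ.im ≠ t ∧ ρ.im ≠ -t := by
    intro a b hab ha hb
    obtain ⟨t, ht, hn⟩ := ((Ioo_infinite hab).sdiff (hBfin.union hBneg)).nonempty
    refine ⟨t, ht, fun ρ hρ => ⟨?_, ?_⟩⟩
    · rintro rfl
      exact hn (Or.inl ⟨ρ, ⟨hρ, by linarith [ht.1], by linarith [ht.2]⟩, rfl⟩)
    · intro he
      exact hn (Or.inr ⟨ρ.im, ⟨ρ, ⟨hρ, by linarith [ht.2], by linarith [ht.1]⟩, rfl⟩, by linarith⟩)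
  obtain ⟨t, ht, htz⟩ := pick T (T + 1) (by linarith) (by linarith) le_rfl
  obtain ⟨u, hu, huz⟩ := pick (T - 1) T (by linarith) (by linarith) (by linarith)
  have ht1 := abs_le.1 (h t (by linarith [ht.1]) htz)
  have hu1 := abs_le.1 (h u (by linarith [hu.1]) huz)
  have m1 : (zetaZeroCount (Ioc 0 T) : ℝ) ≤ zetaZeroCount (Ioo 0 t) := by
    exact_mod_cast zetaZeroCount_mono
      (fun x hx => ⟨hx.1, by linarith [hx.2, ht.1]⟩ : Ioc 0 T ⊆ Ioo 0 t) Ioo_subset_Icc_self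
  have m2 : (zetaZeroCount (Ioo 0 T) : ℝ) ≤ zetaZeroCount (Ioc 0 T) := by
    exact_mod_cast zetaZeroCount_mono Ioo_subset_Ioc_self Ioc_subset_Icc_self
  have m3 : (zetaZeroCount (Ioo 0 u) : ℝ) ≤ zetaZeroCount (Ioo 0 T) := by
    exact_mod_cast zetaZeroCount_mono
      (fun x hx => ⟨hx.1, by linarith [hx.2, hu.2]⟩ : Ioo 0 u ⊆ Ioo 0 T) Ioo_subset_Icc_self
  have hlt : Real.log t ≤ 1 + Real.log T := by
    have e1 : Real.log t ≤ Real.log (T * 2) :=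
      Real.log_le_log (by linarith [ht.1]) (by linarith [ht.2])
    rw [Real.log_mul (by linarith) (by norm_num)] at e1
    linarith [Real.log_two_lt_d9]
  have hlu : Real.log u ≤ Real.log T := Real.log_le_log (by linarith [hu.1]) hu.2.le
  have hstep : ∀ a b : ℝ, 0 < a → a < b → b < a + 1 → 2 * Real.pi ≤ b → b ≤ T + 1 →
      b / (2 * Real.pi) * (Real.log (b / (2 * Real.pi)) - 1) -
        a / (2 * Real.pi) * (Real.log (a / (2 * Real.pi)) - 1) ≤ 1 + Real.log T := by
    intro a b ha hab hb1 hb2 hbT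
    have hb : 0 < b := ha.trans hab
    have e1 := mul_log_sub_one_sub_le (a := a / (2 * Real.pi)) (b := b / (2 * Real.pi))
      (by positivity) (by positivity)
    have e2 : 0 ≤ Real.log (b / (2 * Real.pi)) :=
      Real.log_nonneg ((one_le_div (by positivity)).2 hb2)
    have e3 : b / (2 * Real.pi) - a / (2 * Real.pi) ≤ 1 := by
      rw [← sub_div, div_le_one (by positivity)]; linarith
    have e4 : Real.log (b / (2 * Real.pi)) ≤ Real.log T := by
      refine Real.log_le_log (by positivity) ?_
      rw [div_le_iff₀ (by positivity)]
      nlinarith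
    have e5 : (b / (2 * Real.pi) - a / (2 * Real.pi)) * Real.log (b / (2 * Real.pi)) ≤
        1 * Real.log (b / (2 * Real.pi)) := by gcongr
    linarith
  have s1 := hstep T t (by linarith) ht.1 ht.2 (by linarith [ht.1]) ht.2.le
  have s2 := hstep u T (by linarith [hu.1]) hu.2 (by linarith [hu.1]) hT (by linarith)
  have q1 : K * (1 + Real.log t) ≤ K * (3 * Real.log T) := by gcongr; linarith
  have q2 : K * (1 + Real.log u) ≤ K * (3 * Real.log T) := by gcongr; linarith
  rw [zetaQ, zetaN, zetaL, abs_le]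
  constructor <;> linarith [ht1.2, hu1.1]

end RiemannVonMangoldt

/-! ### Summation by parts over zeros, and the decay of φ. -/

section AbelSummation

theorem monotone_zetaZeroCount_Ioc : Monotone fun t : ℝ => (zetaZeroCount (Ioc 0 t) : ℝ) :=
  fun _ _ h =>
    Nat.cast_le.2 (zetaZeroCount_mono (Ioc_subset_Ioc_right h) Ioc_subset_Icc_self)

theorem monotone_zetaZeroCount_Ioo : Monotone fun t : ℝ => (zetaZeroCount (Ioo 0 t) : ℝ) :=
  fun _ _ h =>
    Nat.cast_le.2 (zetaZeroCount_mono (Ioo_subset_Ioo_right h) Ioo_subset_Icc_self)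

theorem measurable_zetaQ : Measurable zetaQ := by
  have h1 := monotone_zetaZeroCount_Ioc.measurable
  have h2 := monotone_zetaZeroCount_Ioo.measurable
  unfold zetaQ zetaN zetaL
  fun_prop

theorem hasDerivAt_zetaL {t : ℝ} (ht : 0 < t) :
    HasDerivAt zetaL (1 / (2 * Real.pi) * Real.log (t / (2 * Real.pi))) t := by
  have hpi := Real.pi_pos
  have h1 : HasDerivAt (fun t => t / (2 * Real.pi)) (1 / (2 * Real.pi)) t :=
    (hasDerivAt_id t).div_const _
  have h2 := h1.log (by positivity)
  convert! (h1.mul (h2.sub_const 1)).add_const (7 / 8) using 1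
  field_simp
  ring

/-- The normalized jump function at `γ`. -/
noncomputable def jump (γ t : ℝ) : ℝ := ((if γ ≤ t then 1 else 0) + (if γ < t then 1 else 0)) / 2

theorem monotone_jump (γ : ℝ) : Monotone (jump γ) := by
  intro s t hst
  unfold jump
  split_ifs <;> linarith

/-- The index set depends on T only, so N is a fixed finite combination of jumps for all t ≤ T and
partial summation reduces to a single zero. -/
theorem zetaN_eq_sum_jump {t T : ℝ} (htT : t ≤ T)
    (hfin : (zetaZerosWithOrdinateIn (Ioc 0 T)).Finite) :
    zetaN t = ∑ ρ ∈ hfin.toFinset, (zetaZeroMultiplicity ρ : ℝ) * jump ρ.im t := by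
  have h1 : (zetaZeroCount (Ioc 0 t) : ℝ) =
      ∑ ρ ∈ hfin.toFinset, if ρ.im ≤ t then (zetaZeroMultiplicity ρ : ℝ) else 0 := by
    rw [zetaZeroCount_eq_sum (zetaZerosWithOrdinateIn_finite Ioc_subset_Icc_self),
      ← Finset.sum_filter]
    push_cast
    refine Finset.sum_congr ?_ fun _ _ => rfl
    ext ρ
    simp only [Set.Finite.mem_toFinset, Finset.mem_filter, zetaZerosWithOrdinateIn, mem_ofPred_eq,
      mem_Ioc]
    exact ⟨fun h => ⟨⟨h.1, h.2.1, h.2.2.trans htT⟩, h.2.2⟩, fun h => ⟨h.1.1, h.1.2.1, h.2⟩⟩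
  have h2 : (zetaZeroCount (Ioo 0 t) : ℝ) =
      ∑ ρ ∈ hfin.toFinset, if ρ.im < t then (zetaZeroMultiplicity ρ : ℝ) else 0 := by
    rw [zetaZeroCount_eq_sum (zetaZerosWithOrdinateIn_finite Ioo_subset_Icc_self),
      ← Finset.sum_filter]
    push_cast
    refine Finset.sum_congr ?_ fun _ _ => rfl
    ext ρ
    simp only [Set.Finite.mem_toFinset, Finset.mem_filter, zetaZerosWithOrdinateIn, mem_ofPred_eq,
      mem_Ioo, mem_Ioc]
    exact ⟨fun h => ⟨⟨h.1, h.2.1, (h.2.2.trans_le htT).le⟩, h.2.2⟩,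
      fun h => ⟨h.1.1, h.1.2.1, h.2⟩⟩
  rw [zetaN, h1, h2, ← Finset.sum_add_distrib, Finset.sum_div]
  refine Finset.sum_congr rfl fun ρ _ => ?_
  unfold jump
  split_ifs <;> ring

theorem zetaPrimedSum_eq_sum (φ : ℝ → ℝ) {T₀ T : ℝ} (hT₀ : 0 < T₀)
    (hfin : (zetaZerosWithOrdinateIn (Ioc 0 T)).Finite) :
    zetaPrimedSum φ T₀ T = ∑ ρ ∈ hfin.toFinset, (zetaZeroMultiplicity ρ : ℝ) *
      (if T₀ ≤ ρ.im then (if ρ.im = T₀ ∨ ρ.im = T then 1 / 2 else 1) * φ ρ.im else 0) := by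
  classical
  have hf : (zetaZerosWithOrdinateIn (Icc T₀ T)).Finite :=
    zetaZerosWithOrdinateIn_finite (Subset.refl _)
  rw [zetaPrimedSum, finsum_mem_eq_finite_toFinset_sum _ hf]
  simp only [mul_ite, mul_zero]
  rw [← Finset.sum_filter]
  refine Finset.sum_congr ?_ fun ρ _ => ?_
  · ext ρ
    simp only [Set.Finite.mem_toFinset, Finset.mem_filter, zetaZerosWithOrdinateIn, mem_ofPred_eq,
      mem_Icc, mem_Ioc]
    exact ⟨fun h => ⟨⟨h.1, hT₀.trans_le h.2.1, h.2.2⟩, h.2.1⟩, fun h => ⟨h.1.1, h.2, h.1.2.2⟩⟩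
  · split_ifs <;> rfl

variable {T₀ : ℝ} {φ ψ : ℝ → ℝ}

theorem intervalIntegrable_of_continuousOn_Ici {f : ℝ → ℝ} (hf : ContinuousOn f (Ici T₀)) {a b : ℝ}
    (ha : T₀ ≤ a) (hb : T₀ ≤ b) : IntervalIntegrable f volume a b :=
  (hf.mono fun _ hx => (le_inf ha hb).trans hx.1).intervalIntegrable

theorem integral_deriv_Ici (hψ : ContinuousOn ψ (Ici T₀))
    (hd : ∀ t ∈ Ici T₀, HasDerivWithinAt φ (ψ t) (Ici T₀) t) {a b : ℝ} (ha : T₀ ≤ a) (hab : a ≤ b) :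
    ∫ t in a..b, ψ t = φ b - φ a := by
  refine intervalIntegral.integral_eq_sub_of_hasDerivAt_of_le hab
    (fun t ht => ((hd t (ha.trans ht.1)).continuousWithinAt).mono fun x hx => ha.trans hx.1)
    (fun t ht => (hd t (ha.trans ht.1.le)).hasDerivAt (Ici_mem_nhds (ha.trans_lt ht.1)))
    (intervalIntegrable_of_continuousOn_Ici hψ ha (ha.trans hab))

/-- The jump vanishes before γ and is 1 after it, so the integral is φ(T) − φ(max γ T₀). The value
1/2 at γ itself enters only through the boundary terms and gives the half weights at the ends; for γ
< T₀ everything cancels. -/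
theorem integral_mul_jump (hψ : ContinuousOn ψ (Ici T₀))
    (hd : ∀ t ∈ Ici T₀, HasDerivWithinAt φ (ψ t) (Ici T₀) t) {T γ : ℝ} (hT : T₀ < T) (hγ : γ ≤ T) :
    φ T * jump γ T - φ T₀ * jump γ T₀ - ∫ t in T₀..T, ψ t * jump γ t =
      if T₀ ≤ γ then (if γ = T₀ ∨ γ = T then 1 / 2 else 1) * φ γ else 0 := by
  set c := max γ T₀ with hc
  have hcT : c ≤ T := max_le hγ hT.le
  have hcT₀ : T₀ ≤ c := le_max_right _ _
  have hi : ∀ a b, T₀ ≤ a → T₀ ≤ b → IntervalIntegrable (fun t => ψ t * jump γ t) volume a b := by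
    intro a b ha hb
    exact (monotone_jump γ).intervalIntegrable.continuousOn_mul
      (hψ.mono fun _ hx => (le_inf ha hb).trans hx.1)
  have h1 : ∫ t in T₀..c, ψ t * jump γ t = 0 := by
    rw [intervalIntegral.integral_congr_ae (g := fun _ => 0), intervalIntegral.integral_zero]
    have hne : ∀ᵐ t : ℝ, t ≠ c := compl_mem_ae_iff.2 (measure_singleton c)
    filter_upwards [hne] with t hne ht
    rw [uIoc_of_le hcT₀] at ht
    have h2 : t < c := lt_of_le_of_ne ht.2 hne
    have h3 : t < γ := by
      rcases lt_max_iff.1 h2 with h | h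
      · exact h
      · exact absurd h (not_lt.2 ht.1.le)
    simp [jump, not_le.2 h3, not_lt.2 h3.le]
  have h2 : ∫ t in c..T, ψ t * jump γ t = φ T - φ c := by
    rw [← integral_deriv_Ici hψ hd hcT₀ hcT]
    refine intervalIntegral.integral_congr_ae (Eventually.of_forall fun t ht => ?_)
    rw [uIoc_of_le hcT] at ht
    have h3 : γ < t := (le_max_left _ _).trans_lt ht.1
    simp [jump, h3, h3.le]
  rw [← intervalIntegral.integral_add_adjacent_intervals (hi T₀ c le_rfl hcT₀)
    (hi c T hcT₀ hT.le), h1, h2]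
  rcases lt_trichotomy γ T₀ with h | h | h
  · rw [hc, max_eq_right h.le]
    simp [jump, h, h.le, h.trans hT, (h.trans hT).le, not_le.2 h]
  · subst h
    simp [jump, hT, hT.le, hc]
    ring
  · rw [hc, max_eq_left h.le]
    rcases lt_or_eq_of_le hγ with h' | h'
    · simp [jump, h.le, h', h'.le, not_le.2 h, not_lt.2 h.le, h.ne', h'.ne]
    · subst h'
      simp [jump, h.le, not_lt.2 h.le, not_le.2 h]
      ring

theorem intervalIntegrable_mul_zetaN (hψ : ContinuousOn ψ (Ici T₀)) {T : ℝ} (hT : T₀ ≤ T) :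
    IntervalIntegrable (fun t => ψ t * zetaN t) volume T₀ T := by
  refine IntervalIntegrable.continuousOn_mul ?_
    (hψ.mono fun x hx => by rw [uIcc_of_le hT] at hx; exact hx.1)
  exact (monotone_zetaZeroCount_Ioc.intervalIntegrable.add
    monotone_zetaZeroCount_Ioo.intervalIntegrable).div_const 2

/-- Summation by parts for sums over zeros of the zeta function. -/
theorem zetaPrimedSum_eq (hT₀ : 0 < T₀) (hψ : ContinuousOn ψ (Ici T₀))
    (hd : ∀ t ∈ Ici T₀, HasDerivWithinAt φ (ψ t) (Ici T₀) t) {T : ℝ} (hT : T₀ < T) :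
    zetaPrimedSum φ T₀ T = φ T * zetaN T - φ T₀ * zetaN T₀ - ∫ t in T₀..T, ψ t * zetaN t := by
  have hfin : (zetaZerosWithOrdinateIn (Ioc 0 T)).Finite :=
    zetaZerosWithOrdinateIn_finite Ioc_subset_Icc_self
  have hi : ∀ ρ ∈ hfin.toFinset, IntervalIntegrable
      (fun t => (zetaZeroMultiplicity ρ : ℝ) * (ψ t * jump ρ.im t)) volume T₀ T := by
    intro ρ _
    exact ((monotone_jump _).intervalIntegrable.continuousOn_mul
      (hψ.mono fun x hx => by rw [uIcc_of_le hT.le] at hx; exact hx.1)).const_mul _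
  have hint : ∫ t in T₀..T, ψ t * zetaN t = ∑ ρ ∈ hfin.toFinset,
      (zetaZeroMultiplicity ρ : ℝ) * ∫ t in T₀..T, ψ t * jump ρ.im t := by
    rw [intervalIntegral.integral_congr (g := fun t => ∑ ρ ∈ hfin.toFinset,
      (zetaZeroMultiplicity ρ : ℝ) * (ψ t * jump ρ.im t)), intervalIntegral.integral_finsetSum hi]
    · simp only [intervalIntegral.integral_const_mul]
    · intro t ht
      rw [uIcc_of_le hT.le] at ht
      simp only [zetaN_eq_sum_jump ht.2 hfin, Finset.mul_sum]
      exact Finset.sum_congr rfl fun ρ _ => by ring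
  rw [hint, zetaPrimedSum_eq_sum φ hT₀ hfin, zetaN_eq_sum_jump le_rfl hfin,
    zetaN_eq_sum_jump hT.le hfin, Finset.mul_sum, Finset.mul_sum, ← Finset.sum_sub_distrib,
    ← Finset.sum_sub_distrib]
  refine Finset.sum_congr rfl fun ρ hρ => ?_
  rw [Set.Finite.mem_toFinset] at hρ
  rw [← integral_mul_jump hψ hd hT hρ.2.2]
  ring

/-- Integration by parts, needed for u = L and for u = log. -/
theorem integral_mul_add_mul_deriv (hψ : ContinuousOn ψ (Ici T₀))
    (hd : ∀ t ∈ Ici T₀, HasDerivWithinAt φ (ψ t) (Ici T₀) t) {u u' : ℝ → ℝ}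
    (hu : ∀ t ∈ Ici T₀, HasDerivAt u (u' t) t) (hu' : ContinuousOn u' (Ici T₀)) {T : ℝ}
    (hT : T₀ ≤ T) :
    (∫ t in T₀..T, ψ t * u t) + ∫ t in T₀..T, φ t * u' t = φ T * u T - φ T₀ * u T₀ := by
  have hφc : ContinuousOn φ (Ici T₀) := fun t ht => (hd t ht).continuousWithinAt
  have huc : ContinuousOn u (Ici T₀) := fun t ht => (hu t ht).continuousAt.continuousWithinAt
  rw [← intervalIntegral.integral_add
    (intervalIntegrable_of_continuousOn_Ici (hψ.fun_mul huc) le_rfl hT)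
    (intervalIntegrable_of_continuousOn_Ici (hφc.fun_mul hu') le_rfl hT)]
  exact integral_deriv_Ici (φ := fun t => φ t * u t) ((hψ.mul huc).add (hφc.mul hu'))
    (fun t ht => (hd t ht).mul (hu t ht).hasDerivWithinAt) le_rfl hT

theorem zetaPrimedSum_sub_integral_eq (hT₀ : 0 < T₀) (hψ : ContinuousOn ψ (Ici T₀))
    (hd : ∀ t ∈ Ici T₀, HasDerivWithinAt φ (ψ t) (Ici T₀) t) {T : ℝ} (hT : T₀ < T) :
    zetaPrimedSum φ T₀ T -
        1 / (2 * Real.pi) * ∫ t in T₀..T, φ t * Real.log (t / (2 * Real.pi)) =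
      φ T * zetaQ T - φ T₀ * zetaQ T₀ - ∫ t in T₀..T, ψ t * zetaQ t := by
  have hpi := Real.pi_pos
  have hpos : ∀ t ∈ Ici T₀, 0 < t := fun t ht => hT₀.trans_le ht
  have hL : ContinuousOn zetaL (Ici T₀) := fun t ht =>
    (hasDerivAt_zetaL (hpos t ht)).continuousAt.continuousWithinAt
  have hlog : ContinuousOn (fun t => 1 / (2 * Real.pi) * Real.log (t / (2 * Real.pi))) (Ici T₀) := by
    refine continuousOn_const.mul (ContinuousOn.log (by fun_prop) fun t ht => ?_)
    have := hpos t ht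
    positivity
  have h1 := integral_mul_add_mul_deriv hψ hd (fun t ht => hasDerivAt_zetaL (hpos t ht)) hlog hT.le
  have h2 : ∫ t in T₀..T, ψ t * zetaQ t =
      (∫ t in T₀..T, ψ t * zetaN t) - ∫ t in T₀..T, ψ t * zetaL t := by
    rw [← intervalIntegral.integral_sub (intervalIntegrable_mul_zetaN hψ hT.le)
      (intervalIntegrable_of_continuousOn_Ici (hψ.fun_mul hL) le_rfl hT.le)]
    simp only [zetaQ, mul_sub]
  have h3 : ∫ t in T₀..T, φ t * (1 / (2 * Real.pi) * Real.log (t / (2 * Real.pi))) =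
      1 / (2 * Real.pi) * ∫ t in T₀..T, φ t * Real.log (t / (2 * Real.pi)) := by
    rw [← intervalIntegral.integral_const_mul]
    exact intervalIntegral.integral_congr fun t _ => by ring
  rw [zetaPrimedSum_eq hT₀ hψ hd hT, h2, ← h3]
  simp only [zetaQ]
  linarith

theorem antitoneOn_of_hasDerivWithinAt_Ici
    (hd : ∀ t ∈ Ici T₀, HasDerivWithinAt φ (ψ t) (Ici T₀) t) (hψ0 : ∀ t ∈ Ici T₀, ψ t ≤ 0) :
    AntitoneOn φ (Ici T₀) := by
  refine antitoneOn_of_deriv_nonpos (convex_Ici T₀) (fun t ht => (hd t ht).continuousWithinAt) ?_ ?_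
  · intro t ht
    rw [interior_Ici] at ht
    have ht' : t ∈ Ici T₀ := Ioi_subset_Ici_self ht
    exact ((hd t ht').hasDerivAt (Ici_mem_nhds ht)).differentiableAt.differentiableWithinAt
  · intro t ht
    rw [interior_Ici] at ht
    have ht' : t ∈ Ici T₀ := Ioi_subset_Ici_self ht
    rw [((hd t ht').hasDerivAt (Ici_mem_nhds ht)).deriv]
    exact hψ0 t ht'

/-- As φ decreases, φ(T) · (log T)/2 = ∫φ(T)/t dt over [√T, T] is at most ∫φ(t)/t dt over the same
interval, a Cauchy tail of a convergent integral. -/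
theorem tendsto_mul_log_atTop_zero (hT₀ : 1 ≤ T₀) (h0 : ∀ t ∈ Ici T₀, 0 ≤ φ t)
    (hφ : AntitoneOn φ (Ici T₀)) (hi : IntegrableOn (fun t => φ t / t) (Ici T₀)) :
    Tendsto (fun T => φ T * Real.log T) atTop (𝓝 0) := by
  have hJ : Tendsto (fun T => ∫ t in T₀..T, φ t / t) atTop (𝓝 (∫ t in Ioi T₀, φ t / t)) :=
    intervalIntegral_tendsto_integral_Ioi _ (hi.mono_set Ioi_subset_Ici_self) tendsto_id
  have hJ2 := (hJ.sub (hJ.comp Real.tendsto_sqrt_atTop)).const_mul 2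
  rw [sub_self, mul_zero] at hJ2
  refine tendsto_of_tendsto_of_tendsto_of_le_of_le' tendsto_const_nhds hJ2 ?_ ?_
  · filter_upwards [eventually_ge_atTop T₀] with T hT
    exact mul_nonneg (h0 T hT) (Real.log_nonneg (hT₀.trans hT))
  · filter_upwards [eventually_ge_atTop (T₀ ^ 2)] with T hT
    have hs : T₀ ≤ √T := Real.le_sqrt_of_sq_le hT
    have hT1 : 1 ≤ T := by nlinarith
    have hsT : √T ≤ T := by
      rw [Real.sqrt_le_left (by linarith)]; nlinarith
    have hint : ∀ a b, T₀ ≤ a → T₀ ≤ b → IntervalIntegrable (fun t => φ t / t) volume a b :=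
      fun a b ha hb => (hi.mono_set fun x hx => (le_inf ha hb).trans hx.1).intervalIntegrable
    have e1 : (∫ t in T₀..T, φ t / t) - ∫ t in T₀..√T, φ t / t = ∫ t in √T..T, φ t / t :=
      intervalIntegral.integral_interval_sub_left (hint _ _ le_rfl (hs.trans hsT)) (hint _ _ le_rfl hs)
    have hs0 : 0 < √T := by linarith
    have e2 : ∫ t in √T..T, φ T / t = φ T * (Real.log T / 2) := by
      simp only [div_eq_mul_inv (φ T)]
      rw [intervalIntegral.integral_const_mul, integral_inv_of_pos hs0 (by linarith),
        Real.log_div (by linarith) hs0.ne', Real.log_sqrt (by linarith)]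
      ring
    have e3 : ∫ t in √T..T, φ T / t ≤ ∫ t in √T..T, φ t / t := by
      refine intervalIntegral.integral_mono_on hsT ?_ (hint _ _ hs (hs.trans hsT)) fun t ht => ?_
      · refine ContinuousOn.intervalIntegrable (continuousOn_const.div continuousOn_id fun t ht => ?_)
        rw [uIcc_of_le hsT] at ht
        exact (hs0.trans_le ht.1).ne'
      · have := hs0.trans_le ht.1
        have := hφ (hs.trans ht.1) (hs.trans hsT) ht.2
        gcongr
    simp only [Function.comp]
    rw [e1]
    linarith

/-- The integrand has constant sign, so by parts ∫|φ'| log t over [T₀, T] equals φ(T₀) log T₀ − φ(T)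
log T + ∫φ(t)/t dt, and the middle term may be dropped. -/
theorem integrableOn_mul_log (hT₀ : 1 ≤ T₀) (h0 : ∀ t ∈ Ici T₀, 0 ≤ φ t)
    (hψ : ContinuousOn ψ (Ici T₀)) (hψ0 : ∀ t ∈ Ici T₀, ψ t ≤ 0)
    (hd : ∀ t ∈ Ici T₀, HasDerivWithinAt φ (ψ t) (Ici T₀) t)
    (hi : IntegrableOn (fun t => φ t / t) (Ici T₀)) :
    IntegrableOn (fun t => ψ t * Real.log t) (Ioi T₀) := by
  have hpos : ∀ t ∈ Ici T₀, t ≠ 0 := fun t ht => by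
    have : T₀ ≤ t := ht
    linarith
  have hc : ContinuousOn (fun t => ψ t * Real.log t) (Ici T₀) :=
    hψ.mul (Real.continuousOn_log.mono hpos)
  refine integrableOn_Ioi_of_intervalIntegral_norm_bounded
    (φ T₀ * Real.log T₀ + ∫ t in Ioi T₀, φ t / t) T₀
    (fun T => ((hc.mono Icc_subset_Ici_self).integrableOn_Icc).mono_set Ioc_subset_Icc_self)
    tendsto_id ?_
  filter_upwards [eventually_ge_atTop T₀] with T hT
  have h1 := integral_mul_add_mul_deriv hψ hd (fun t ht => Real.hasDerivAt_log (hpos t ht))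
    (continuousOn_inv₀.mono hpos) hT
  have h2 : ∫ t in T₀..T, ‖ψ t * Real.log t‖ = -∫ t in T₀..T, ψ t * Real.log t := by
    rw [← intervalIntegral.integral_neg]
    refine intervalIntegral.integral_congr fun t ht => ?_
    rw [uIcc_of_le hT] at ht
    exact Real.norm_of_nonpos
      (mul_nonpos_of_nonpos_of_nonneg (hψ0 t ht.1) (Real.log_nonneg (hT₀.trans ht.1)))
  have h3 : ∫ t in T₀..T, φ t * t⁻¹ ≤ ∫ t in Ioi T₀, φ t / t := by
    rw [intervalIntegral.integral_of_le hT]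
    refine setIntegral_mono_set (hi.mono_set Ioi_subset_Ici_self) ?_
      (Eventually.of_forall Ioc_subset_Ioi_self)
    refine (ae_restrict_iff' measurableSet_Ioi).2 (Eventually.of_forall fun t ht => ?_)
    have : T₀ < t := ht
    exact div_nonneg (h0 t this.le) (by linarith)
  have h4 : 0 ≤ φ T * Real.log T := mul_nonneg (h0 T hT) (Real.log_nonneg (hT₀.trans hT))
  simp only [id]
  rw [h2]
  linarith

end AbelSummation

/-! ### Passage to the limit. -/

theorem theorem2 (T₀ : ℝ) (hT₀ : 2 * Real.pi ≤ T₀) (φ : ℝ → ℝ)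
    (hφ_nonneg : ∀ t ∈ Ici T₀, 0 ≤ φ t)
    (hφ_smooth : ContDiffOn ℝ 2 φ (Ici T₀))
    (hφ_deriv : ∀ t ∈ Ici T₀, derivWithin φ (Ici T₀) t ≤ 0)
    (hφ_deriv2 : ∀ t ∈ Ici T₀, 0 ≤ iteratedDerivWithin 2 φ (Ici T₀) t)
    (hφ_int : IntegrableOn (fun t => φ t / t) (Ici T₀)) :
    IntegrableOn (fun t => derivWithin φ (Ici T₀) t * zetaQ t) (Ici T₀) ∧
    ∃ F : ℝ,
      Tendsto (fun T : ℝ => zetaPrimedSum φ T₀ T -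
          1 / (2 * Real.pi) * ∫ t in T₀..T, φ t * Real.log (t / (2 * Real.pi)))
        atTop (𝓝 F) ∧
      F = -φ T₀ * zetaQ T₀ - ∫ t in Ici T₀, derivWithin φ (Ici T₀) t * zetaQ t := by
  have hpi := Real.pi_gt_three
  have hT1 : 1 ≤ T₀ := by linarith
  obtain ⟨K, hK, hQ⟩ := abs_zetaQ_le
  have hψ : ContinuousOn (derivWithin φ (Ici T₀)) (Ici T₀) :=
    hφ_smooth.continuousOn_derivWithin (uniqueDiffOn_Ici T₀) (by norm_num)
  have hd : ∀ t ∈ Ici T₀, HasDerivWithinAt φ (derivWithin φ (Ici T₀) t) (Ici T₀) t := fun t ht =>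
    (hφ_smooth.differentiableOn (by norm_num) t ht).hasDerivWithinAt
  have hanti := antitoneOn_of_hasDerivWithinAt_Ici hd hφ_deriv
  have hIoi : IntegrableOn (fun t => derivWithin φ (Ici T₀) t * zetaQ t) (Ioi T₀) := by
    refine Integrable.mono' (g := fun t => K * ‖derivWithin φ (Ici T₀) t * Real.log t‖)
      ((integrableOn_mul_log hT1 hφ_nonneg hψ hφ_deriv hd hφ_int).norm.const_mul K) ?_ ?_
    · exact ((hψ.mono Ioi_subset_Ici_self).aestronglyMeasurable measurableSet_Ioi).mul
        measurable_zetaQ.aestronglyMeasurable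
    · refine (ae_restrict_iff' measurableSet_Ioi).2 (Eventually.of_forall fun t ht => ?_)
      have ht : T₀ < t := ht
      have hl : 0 ≤ Real.log t := Real.log_nonneg (by linarith)
      rw [norm_mul, norm_mul, Real.norm_eq_abs (zetaQ t), Real.norm_of_nonneg hl]
      calc ‖derivWithin φ (Ici T₀) t‖ * |zetaQ t| ≤
            ‖derivWithin φ (Ici T₀) t‖ * (K * Real.log t) := by
            gcongr; exact hQ t (by linarith)
        _ = _ := by ring
  refine ⟨(integrableOn_Ici_iff_integrableOn_Ioi (by exact enorm_ne_top)).2 hIoi, _, ?_, rfl⟩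
  -- This is the only boundary term of the finite identity that depends on T.
  have hφQ : Tendsto (fun T => φ T * zetaQ T) atTop (𝓝 0) := by
    have h1 := (tendsto_mul_log_atTop_zero hT1 hφ_nonneg hanti hφ_int).const_mul K
    rw [mul_zero] at h1
    refine squeeze_zero_norm' ?_ h1
    filter_upwards [eventually_ge_atTop T₀] with T hT
    rw [norm_mul, Real.norm_of_nonneg (hφ_nonneg T hT), Real.norm_eq_abs]
    calc φ T * |zetaQ T| ≤ φ T * (K * Real.log T) := by
          gcongr
          · exact hφ_nonneg T hT
          · exact hQ T (hT₀.trans hT)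
      _ = _ := by ring
  have hlim := (hφQ.sub_const (φ T₀ * zetaQ T₀)).sub
    (intervalIntegral_tendsto_integral_Ioi T₀ hIoi tendsto_id)
  rw [integral_Ici_eq_integral_Ioi, neg_mul, ← zero_sub]
  refine hlim.congr' ?_
  filter_upwards [eventually_gt_atTop T₀] with T hT
  exact (zetaPrimedSum_sub_integral_eq (by linarith) hψ hd hT).symm
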